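/- For $N\ge 0$ let $\mathrm{Sym}(N)\subset\mathbb R[x_1,\dots,x_N]$ be the algebra of symmetric polynomials, and let $\mathrm{Sym}$ be the algebra of symmetric functions: the sequences $(f_N)$, $f_N\in\mathrm{Sym}(N)$, with $f_N(x_1,\dots,x_{N-1},0)=f_{N-1}(x_1,\dots,x_{N-1})$ for all $N\ge1$ and $\sup_N\deg f_N<\infty$. Let $\mathrm{Sym}_{\mathbb C}=\mathrm{Sym}\otimes_{\mathbb R}\mathbb C$, let $e_k\in\mathrm{Sym}$ be the elementary symmetric functions, and for a Young diagram $\nu$ let $S_\nu=(S_{\nu|N})_N\in\mathrm{Sym}$ be the Schur function, where $$S_{\nu|N}=\frac{\det\big[x_j^{\nu_i+N-i}\big]_{i,j=1}^N}{\prod_{1\le i<j\le N}(x_i-x_j)}\quad\text{if }\nu\text{ has at most }N\text{ nonzero rows, and } S_{\nu|N}=0\text{ otherwise.}$$ Let $|\nu|$ be the number of boxes of $\nu$, let $\nu^-$ be the set of boxes $\square$ of $\nu$ for which $\nu\setminus\square$ is again a Young diagram, and let $c(\square)=j-i$ for the box $\square$ in row $i$ and column $j$. **Theorem.** Let $z,z'\in\mathbb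 C$. The algebra morphism $\mathbb C[e_1,e_2,\dots]\to\mathrm{Sym}_{\mathbb C}$ from the polynomial algebra in formal variables $e_1,e_2,\dots$, sending each variable $e_n$ to the $n$-th elementary symmetric function, is bijective. There is exactly one linear operator $\mathcal D^{\mathrm{La}}:\mathrm{Sym}_{\mathbb C}\to\mathrm{Sym}_{\mathbb C}$ (the Laguerre operator with parameters $z,z'$) such that for every Young diagram $\nu$ $$\mathcal D^{\mathrm{La}}S_\nu=-|\nu|\,S_\nu+\sum_{\square\in\nu^-}(z+c(\square))(z'+c(\square))\,S_{\nu\setminus\square}.$$ Upon the identification $\mathrm{Sym}_{\mathbb C}=\mathbb C[e_1,e_2,\dots]$, this operator is the second order differential operator $$\begin{aligned}\mathcal D^{\mathrm{La}}&=\sum_{n\ge1}\Big(\sum_{k=0}^{n-1}(2n-1-2k)\,e_{2n-1-k}e_k\Big)\frac{\partial^2}{\partial e_n^2}\\&\quad+2\sum_{m>n\ge1}\Big(\sum_{k=0}^{n-1}(m+n-1-2k)\,e_{m+n-1-k}e_k\Big)\frac{\partial^2}{\partial e_m\,\partial e_n}\\&\quad+\sum_{n\ge1}\big(-n e_n+(z-n+1)(z'-n+1)e_{n-1}\big)\frac{\partial}{\partial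 e_n},\end{aligned}$$ where $e_0=1$. -/

import Mathlib

open scoped TensorProduct

noncomputable section

namespace LaguerreSym

open MvPolynomial

/-! ### The algebra of symmetric functions -/

/-- The algebra morphism `ℝ[x₁,…,x_{N+1}] → ℝ[x₁,…,x_N]` setting the last variable to `0`. -/
def setLastZero (N : ℕ) : MvPolynomial (Fin (N + 1)) ℝ →ₐ[ℝ] MvPolynomial (Fin N) ℝ :=
  aeval (Fin.snoc (α := fun _ => MvPolynomial (Fin N) ℝ) X 0)

/-- The algebra `Sym` of symmetric functions over `ℝ`: sequences `(f_N)` of symmetric polynomials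
`f_N ∈ Sym(N)`, compatible with setting the last variable to `0`, with `sup deg f_N < ∞`.
(The term `f_0`, a constant, is determined by `f_1`.) -/
def Sym : Subalgebra ℝ (∀ N : ℕ, MvPolynomial (Fin N) ℝ) where
  carrier := {f | (∀ N, f N ∈ symmetricSubalgebra (Fin N) ℝ) ∧
    (∀ N, setLastZero N (f (N + 1)) = f N) ∧ ∃ d : ℕ, ∀ N, (f N).totalDegree ≤ d}
  mul_mem' := by
    rintro f g ⟨hf, hf', a, ha⟩ ⟨hg, hg', b, hb⟩
    refine ⟨fun N => mul_mem (hf N) (hg N), fun N => ?_, a + b, fun N => ?_⟩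
    · simp [hf', hg']
    · exact (totalDegree_mul _ _).trans (add_le_add (ha N) (hb N))
  add_mem' := by
    rintro f g ⟨hf, hf', a, ha⟩ ⟨hg, hg', b, hb⟩
    refine ⟨fun N => add_mem (hf N) (hg N), fun N => ?_, max a b, fun N => ?_⟩
    · simp [hf', hg']
    · exact (totalDegree_add _ _).trans (max_le_max (ha N) (hb N))
  algebraMap_mem' := by
    intro r
    refine ⟨fun N => (symmetricSubalgebra (Fin N) ℝ).algebraMap_mem r, fun N => ?_, 0, fun N => ?_⟩
    · simp [Pi.algebraMap_apply]
    · simp [Pi.algebraMap_apply, algebraMap_eq]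

/-- The complexification `Sym_ℂ`. -/
abbrev SymC : Type := ℂ ⊗[ℝ] Sym

/-! ### Elementary symmetric functions -/

theorem setLastZero_esymm (N k : ℕ) :
    setLastZero N (esymm (Fin (N + 1)) ℝ k) = esymm (Fin N) ℝ k := by
  rw [setLastZero, aeval_esymm_eq_multiset_esymm, esymm_eq_multiset_esymm]
  have h : (Finset.univ.val.map
      (Fin.snoc (α := fun _ => MvPolynomial (Fin N) ℝ) X 0) : Multiset (MvPolynomial (Fin N) ℝ))
      = 0 ::ₘ Finset.univ.val.map X := by
    rw [Fin.univ_castSuccEmb]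
    simp
  rw [h]
  cases k with
  | zero => simp [Multiset.esymm]
  | succ k =>
    rw [Multiset.esymm, Multiset.powersetCard_cons]
    simp [Multiset.esymm]

/-- The elementary symmetric function `e_k = ∑_{i₁ < ⋯ < i_k} x_{i₁} ⋯ x_{i_k}`. -/
def elemSym (k : ℕ) : Sym :=
  ⟨fun N => esymm (Fin N) ℝ k, fun N => esymm_isSymmetric _ _ k, fun N => setLastZero_esymm N k, k,
    fun N => by
      refine (totalDegree_finsetSum _ _).trans (Finset.sup_le fun t ht => ?_)
      refine (totalDegree_finsetProd _ _).trans ?_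
      simp [(Finset.mem_powersetCard.mp ht).2]⟩

/-- The algebra morphism `ℂ[e₁, e₂, …] → Sym_ℂ` sending the variable with index `n ≥ 1` to the
elementary symmetric function `e_n`. -/
def ofElem : MvPolynomial ℕ+ ℂ →ₐ[ℂ] SymC :=
  aeval fun n : ℕ+ => (1 : ℂ) ⊗ₜ[ℝ] elemSym n

/-! ### Schur polynomials and Schur functions -/

/-- The Vandermonde `V_N = ∏_{i < j} (x_i - x_j)`. -/
def vandermondePoly (N : ℕ) : MvPolynomial (Fin N) ℝ :=
  ∏ i : Fin N, ∏ j ∈ Finset.Ioi i, (X i - X j)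

/-- The alternant `det [x_j ^ (ν_i + N - i)]` (with `i` counted from `1`), where `ν_i` are the row
lengths of `ν`. -/
def alternant (N : ℕ) (ν : YoungDiagram) : MvPolynomial (Fin N) ℝ :=
  Matrix.det (Matrix.of fun i j : Fin N => X j ^ (ν.rowLen i + (N - 1 - i)))

theorem vandermondePoly_ne_zero (N : ℕ) : vandermondePoly N ≠ 0 := by
  refine Finset.prod_ne_zero_iff.mpr fun i _ => Finset.prod_ne_zero_iff.mpr fun j hj => ?_
  rw [sub_ne_zero]
  exact fun h => (Finset.mem_Ioi.mp hj).ne (X_injective h)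

theorem rowLen_bot (i : ℕ) : (⊥ : YoungDiagram).rowLen i = 0 := by
  by_contra h
  exact YoungDiagram.notMem_bot (i, 0) (YoungDiagram.mem_iff_lt_rowLen.mpr (Nat.pos_of_ne_zero h))

theorem vandermondePoly_eq (N : ℕ) : vandermondePoly N = alternant N ⊥ := by
  have h := Matrix.det_projVandermonde (1 : Fin N → MvPolynomial (Fin N) ℝ) X
  rw [vandermondePoly, alternant, ← Matrix.det_transpose]
  simp only [Pi.one_apply, one_mul] at h
  rw [← h]
  congr 1
  ext1 i j
  rw [Matrix.projVandermonde_apply, Matrix.transpose_apply, Matrix.of_apply, rowLen_bot]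
  simp only [Pi.one_apply, one_pow, one_mul, Fin.val_rev, zero_add]
  congr 1
  omega

theorem rename_alternant {N : ℕ} (ν : YoungDiagram) (σ : Equiv.Perm (Fin N)) :
    rename σ (alternant N ν) = (Equiv.Perm.sign σ : ℤ) • alternant N ν := by
  have h : rename σ (alternant N ν) = Matrix.det ((Matrix.of fun i j : Fin N =>
      (X j ^ (ν.rowLen i + (N - 1 - i)) : MvPolynomial (Fin N) ℝ)).submatrix id σ) := by
    rw [alternant, AlgHom.map_det]
    congr 1
    ext1 i j
    simp
  rw [h, Matrix.det_permute', alternant]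
  simp

theorem sub_dvd_iff {N : ℕ} (i j : Fin N) (f : MvPolynomial (Fin N) ℝ) :
    (X i - X j) ∣ f ↔ aeval (Function.update X i (X j)) f = (0 : MvPolynomial (Fin N) ℝ) := by
  constructor
  · rintro ⟨g, rfl⟩
    by_cases hij : j = i
    · subst hij; simp
    · simp [Function.update_of_ne hij]
  · intro h
    have key : (X i - X j) ∣ f - aeval (Function.update X i (X j)) f := by
      rw [← Ideal.mem_span_singleton, ← Ideal.Quotient.eq]
      have : (Ideal.Quotient.mkₐ ℝ (Ideal.span {(X i - X j : MvPolynomial (Fin N) ℝ)})) =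
          (Ideal.Quotient.mkₐ ℝ (Ideal.span {(X i - X j : MvPolynomial (Fin N) ℝ)})).comp
            (aeval (Function.update X i (X j))) := by
        refine algHom_ext fun k => ?_
        by_cases hk : k = i
        · subst hk
          simp only [Ideal.Quotient.mkₐ_eq_mk, AlgHom.comp_apply, aeval_X, Function.update_self]
          rw [Ideal.Quotient.eq, Ideal.mem_span_singleton]
        · simp [Function.update_of_ne hk]
      exact congrArg (fun φ => φ f) this
    rwa [h, sub_zero] at key

theorem prime_sub {N : ℕ} {i j : Fin N} (hij : i < j) :
    Prime (X i - X j : MvPolynomial (Fin N) ℝ) := by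
  refine ⟨?_, ?_, ?_⟩
  · rw [sub_ne_zero]
    exact fun h => hij.ne (X_injective h)
  · rw [isUnit_iff_dvd_one, sub_dvd_iff]
    simp
  · intro a b
    simp only [sub_dvd_iff, map_mul, mul_eq_zero, imp_self]

theorem vandermondePoly_dvd (N : ℕ) (ν : YoungDiagram) : vandermondePoly N ∣ alternant N ν := by
  rw [vandermondePoly, Finset.prod_sigma']
  refine Finset.prod_dvd_of_isRelPrime ?_ ?_
  · rintro ⟨i, j⟩ hij ⟨k, l⟩ hkl hne
    simp only [Finset.coe_sigma, Set.mem_sigma_iff, Finset.coe_univ, Set.mem_univ, true_and,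
      Finset.mem_coe, Finset.mem_Ioi] at hij hkl
    change IsRelPrime (X i - X j) (X k - X l)
    rw [(prime_sub hij).irreducible.isRelPrime_iff_not_dvd, sub_dvd_iff]
    intro h
    rw [map_sub, aeval_X, aeval_X, sub_eq_zero] at h
    by_cases hk : k = i
    · subst hk
      rw [Function.update_self, Function.update_of_ne hkl.ne'] at h
      exact hne (by rw [X_injective h])
    · by_cases hl : l = i
      · subst hl
        rw [Function.update_self, Function.update_of_ne hk] at h
        have := X_injective h
        subst this
        exact absurd hij (not_lt.mpr hkl.le)
      · rw [Function.update_of_ne hk, Function.update_of_ne hl] at h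
        exact hkl.ne (X_injective h)
  · rintro ⟨i, j⟩ hij
    simp only [Finset.mem_sigma, Finset.mem_univ, true_and, Finset.mem_Ioi] at hij
    rw [sub_dvd_iff, alternant, AlgHom.map_det]
    refine Matrix.det_zero_of_column_eq hij.ne fun k => ?_
    simp [Function.update_of_ne hij.ne']

/-- The Schur polynomial `S_{ν|N} = det [x_j ^ (ν_i + N - i)] / V_N`, and `0` if `N < ℓ(ν)`.
Here `ℓ(ν)` is the length of the first column of `ν`. -/
def schurPoly (N : ℕ) (ν : YoungDiagram) : MvPolynomial (Fin N) ℝ :=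
  if ν.colLen 0 ≤ N then (vandermondePoly_dvd N ν).choose else 0

theorem vandermondePoly_mul_schurPoly {N : ℕ} {ν : YoungDiagram} (h : ν.colLen 0 ≤ N) :
    vandermondePoly N * schurPoly N ν = alternant N ν := by
  rw [schurPoly, if_pos h]
  exact (vandermondePoly_dvd N ν).choose_spec.symm

theorem schurPoly_mem (N : ℕ) (ν : YoungDiagram) :
    schurPoly N ν ∈ symmetricSubalgebra (Fin N) ℝ := by
  by_cases h : ν.colLen 0 ≤ N
  · intro σ
    have h1 := congrArg (rename σ) (vandermondePoly_mul_schurPoly h)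
    rw [map_mul, vandermondePoly_eq, rename_alternant, rename_alternant, ← vandermondePoly_eq,
      smul_mul_assoc, ← vandermondePoly_mul_schurPoly h] at h1
    refine mul_left_cancel₀ (vandermondePoly_ne_zero N) ?_
    rcases Int.units_eq_one_or (Equiv.Perm.sign σ) with hs | hs <;> simpa [hs] using h1
  · rw [schurPoly, if_neg h]
    exact zero_mem _

theorem rowLen_eq_zero {ν : YoungDiagram} {i : ℕ} (h : ν.colLen 0 ≤ i) : ν.rowLen i = 0 := by
  by_contra h0
  have : (i, 0) ∈ ν := YoungDiagram.mem_iff_lt_rowLen.mpr (Nat.pos_of_ne_zero h0)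
  exact absurd (YoungDiagram.mem_iff_lt_colLen.mp this) (not_lt.mpr h)

theorem setLastZero_alternant {N : ℕ} {ν : YoungDiagram} (h : ν.colLen 0 ≤ N) :
    setLastZero N (alternant (N + 1) ν) = (∏ j, X j) * alternant N ν := by
  rw [alternant, AlgHom.map_det, Matrix.det_succ_column _ (Fin.last N), Fin.sum_univ_castSucc,
    Finset.sum_eq_zero, zero_add]
  · have h1 : (setLastZero N).mapMatrix (Matrix.of fun i j : Fin (N + 1) =>
        (X j ^ (ν.rowLen i + (N + 1 - 1 - i)) : MvPolynomial (Fin (N + 1)) ℝ))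
        (Fin.last N) (Fin.last N) = 1 := by
      simp [setLastZero, rowLen_eq_zero h]
    rw [h1, alternant, ← Matrix.det_mul_row]
    have h2 : (-1 : MvPolynomial (Fin N) ℝ) ^ ((Fin.last N : ℕ) + (Fin.last N : ℕ)) = 1 :=
      Even.neg_one_pow ⟨_, rfl⟩
    rw [h2, one_mul, one_mul]
    congr 1
    ext1 i j
    simp only [Fin.succAbove_last, Matrix.submatrix_apply, AlgHom.mapMatrix_apply, Matrix.map_apply,
      Matrix.of_apply, map_pow, setLastZero, aeval_X, Fin.snoc_castSucc, Fin.val_castSucc]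
    rw [← pow_succ']
    congr 1
    have := i.2
    omega
  · intro i _
    have := i.2
    have h3 : ν.rowLen i = 0 → ¬ N - (i : ℕ) = 0 := fun _ => by omega
    refine mul_eq_zero_of_left (mul_eq_zero_of_right _ ?_) _
    simpa [setLastZero] using h3

theorem setLastZero_schurPoly (N : ℕ) (ν : YoungDiagram) :
    setLastZero N (schurPoly (N + 1) ν) = schurPoly N ν := by
  have hV : setLastZero N (vandermondePoly (N + 1)) = (∏ j, X j) * vandermondePoly N := by
    rw [vandermondePoly_eq, vandermondePoly_eq]
    refine setLastZero_alternant ?_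
    rw [← YoungDiagram.rowLen_transpose]
    have : (⊥ : YoungDiagram).transpose = ⊥ := by
      ext x; simp
    rw [this, rowLen_bot]
    exact Nat.zero_le _
  have hX : (∏ j, X j : MvPolynomial (Fin N) ℝ) * vandermondePoly N ≠ 0 :=
    mul_ne_zero (Finset.prod_ne_zero_iff.mpr fun j _ => X_ne_zero j) (vandermondePoly_ne_zero N)
  by_cases h1 : ν.colLen 0 ≤ N + 1
  · have h2 := congrArg (setLastZero N) (vandermondePoly_mul_schurPoly h1)
    rw [map_mul, hV] at h2
    refine mul_left_cancel₀ hX ?_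
    rw [h2]
    by_cases h : ν.colLen 0 ≤ N
    · rw [setLastZero_alternant h, mul_assoc, vandermondePoly_mul_schurPoly h]
    · rw [schurPoly, if_neg h, mul_zero, alternant, AlgHom.map_det]
      refine Matrix.det_eq_zero_of_column_eq_zero (Fin.last N) fun i => ?_
      have h3 : (i.val, 0) ∈ ν := YoungDiagram.mem_iff_lt_colLen.mpr (by have := i.2; omega)
      have h4 := YoungDiagram.mem_iff_lt_rowLen.mp h3
      simpa [setLastZero] using fun h5 : ν.rowLen i = 0 => absurd h5 h4.ne'
  · rw [schurPoly, if_neg h1, schurPoly, if_neg (by omega), map_zero]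

theorem sum_rowLen_le (N : ℕ) (ν : YoungDiagram) : ∑ i : Fin N, ν.rowLen i ≤ ν.card := by
  simp only [YoungDiagram.rowLen_eq_card]
  rw [← Finset.card_biUnion]
  · refine Finset.card_le_card fun c hc => ?_
    obtain ⟨i, -, hi⟩ := Finset.mem_biUnion.mp hc
    exact (YoungDiagram.mem_row_iff.mp hi).1
  · intro i _ j _ hij
    rw [Function.onFun, Finset.disjoint_left]
    intro c hc hc'
    exact hij (Fin.ext ((YoungDiagram.mem_row_iff.mp hc).2.symm.trans
      (YoungDiagram.mem_row_iff.mp hc').2))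

theorem totalDegree_schurPoly_le (N : ℕ) (ν : YoungDiagram) :
    (schurPoly N ν).totalDegree ≤ ν.card := by
  by_cases h0 : schurPoly N ν = 0
  · simp [h0]
  by_cases h : ν.colLen 0 ≤ N
  · have hV : (vandermondePoly N).totalDegree = ∑ i : Fin N, (N - 1 - i) := by
      refine IsHomogeneous.totalDegree ?_ (vandermondePoly_ne_zero N)
      refine IsHomogeneous.prod _ _ _ fun i _ => ?_
      have := IsHomogeneous.prod (Finset.Ioi i) (fun j => (X i - X j : MvPolynomial (Fin N) ℝ))
        (fun _ => 1) fun j _ => (isHomogeneous_X ℝ i).sub (isHomogeneous_X ℝ j)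
      simpa using this
    have hA : (alternant N ν).totalDegree ≤ ∑ i : Fin N, (ν.rowLen i + (N - 1 - i)) := by
      rw [alternant, ← Matrix.det_transpose, Matrix.det_apply]
      refine (totalDegree_finsetSum _ _).trans (Finset.sup_le fun σ _ => ?_)
      have h1 : (∏ i, (Matrix.of fun i j : Fin N =>
          (X j ^ (ν.rowLen i + (N - 1 - i)) : MvPolynomial (Fin N) ℝ)).transpose (σ i) i).totalDegree
          ≤ ∑ i : Fin N, (ν.rowLen i + (N - 1 - i)) := by
        refine (totalDegree_finsetProd _ _).trans (Finset.sum_le_sum fun i _ => ?_)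
        simp
      rcases Int.units_eq_one_or (Equiv.Perm.sign σ) with hs | hs
      · simpa only [hs, one_smul] using h1
      · rw [hs, Units.neg_smul, one_smul, totalDegree_neg]
        exact h1
    rw [← vandermondePoly_mul_schurPoly h,
      totalDegree_mul_of_isDomain (vandermondePoly_ne_zero N) h0, hV,
      Finset.sum_add_distrib] at hA
    have := sum_rowLen_le N ν
    omega
  · rw [schurPoly, if_neg h]
    simp

/-- The Schur symmetric function `S_ν ∈ Sym`, whose image in each `Sym(N)` is `S_{ν|N}`. -/
def schur (ν : YoungDiagram) : Sym :=
  ⟨fun N => schurPoly N ν, fun N => schurPoly_mem N ν, fun N => setLastZero_schurPoly N ν, ν.card,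
    fun N => totalDegree_schurPoly_le N ν⟩

/-- The Schur symmetric function `S_ν` as an element of `Sym_ℂ`. -/
def schurC (ν : YoungDiagram) : SymC :=
  (1 : ℂ) ⊗ₜ[ℝ] schur ν

/-! ### The Laguerre operator -/

open Classical in
/-- The set `ν⁻` of corner boxes of `ν`: those boxes whose removal leaves a Young diagram. -/
def corners (ν : YoungDiagram) : Finset (ℕ × ℕ) :=
  ν.cells.filter fun c => IsLowerSet (↑(ν.cells.erase c) : Set (ℕ × ℕ))

/-- The Young diagram `ν ∖ □` for a corner box `□` of `ν`. -/
def removeCorner (ν : YoungDiagram) (c : {c // c ∈ corners ν}) : YoungDiagram where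
  cells := ν.cells.erase c
  isLowerSet := by
    classical exact (Finset.mem_filter.mp c.2).2

/-- The content (column number minus row number) of a box. -/
def content (c : ℕ × ℕ) : ℤ := (c.2 : ℤ) - (c.1 : ℤ)

/-- `D` is the Laguerre operator on `Sym_ℂ` with parameters `z, z'`: for every Young diagram `ν`,
`D S_ν = -|ν| S_ν + ∑_{□ ∈ ν⁻} (z + c(□)) (z' + c(□)) S_{ν ∖ □}`. -/
def IsLaguerreOperator (z z' : ℂ) (D : SymC →ₗ[ℂ] SymC) : Prop :=
  ∀ ν : YoungDiagram,
    D (schurC ν) = -(ν.card : ℂ) • schurC ν +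
      ∑ c : {c // c ∈ corners ν},
        ((z + content c) * (z' + content c)) • schurC (removeCorner ν c)

/-! ### The differential operator in the variables `e₁, e₂, …` -/

/-- The element `e_k` of `ℂ[e₁, e₂, …]`, where `e_0 = 1`. -/
def e (k : ℕ) : MvPolynomial ℕ+ ℂ :=
  if h : 0 < k then X ⟨k, h⟩ else 1

/-- For `m ≥ n ≥ 1`, the polynomial `∑_{k=0}^{n-1} (m + n - 1 - 2k) e_{m+n-1-k} e_k`. -/
def secondOrderCoeff (m n : ℕ) : MvPolynomial ℕ+ ℂ :=
  ∑ k ∈ Finset.range n, ((m : ℂ) + n - 1 - 2 * k) • (e (m + n - 1 - k) * e k)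

/-- The polynomial `-n e_n + (z - n + 1) (z' - n + 1) e_{n-1}`. -/
def firstOrderCoeff (z z' : ℂ) (n : ℕ) : MvPolynomial ℕ+ ℂ :=
  -(n : ℂ) • e n + ((z - n + 1) * (z' - n + 1)) • e (n - 1)

/-- The formal differential operator
`∑_n A_{nn} ∂²/∂e_n² + 2 ∑_{m>n} A_{mn} ∂²/∂e_m∂e_n + ∑_n B_n ∂/∂e_n` applied to a polynomial `P`.
All three sums are finite, since `∂P/∂e_n = 0` unless the variable `e_n` occurs in `P`. -/
def diffOp (z z' : ℂ) (P : MvPolynomial ℕ+ ℂ) : MvPolynomial ℕ+ ℂ :=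
  (∑ᶠ n : ℕ+, secondOrderCoeff n n * pderiv n (pderiv n P))
    + 2 * (∑ᶠ p : {p : ℕ+ × ℕ+ // p.2 < p.1},
        secondOrderCoeff p.1.1 p.1.2 * pderiv p.1.1 (pderiv p.1.2 P))
    + ∑ᶠ n : ℕ+, firstOrderCoeff z z' n * pderiv n P

end LaguerreSym

end

/-! The operator is realised in `N` variables by `laguerreSum`, a sum of one-variable Laguerre
operators, conjugated by the Vandermonde `V`. With `b = z' - N + 1`, applying it to `V * f` gives
two descriptions of the same action in the case `z = N`.

On the Schur side, `V * S_ν` is an alternant. A one-variable Laguerre operator lowers one exponent,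
and the result vanishes by equality of two rows unless a corner box has been removed. The exponent
of the corner's row is `N + c`, so the coefficient is `(N + c) * (N + c - 1 + b) = (N + c) * (z' +
c)` (`laguerreSum_vandermonde_mul_schurPoly`). On the elementary side, the chain rule in the `e_n`
needs only `∑ xᵢ ∂ᵢe_m ∂ᵢe_n` (`esymmGamma_eq_sum`) and the cross term with `V`
(`two_mul_sum_pderiv_vandermonde`). The outcome is the stated differential operator at `z = N`
(`laguerreSum_vandermonde_mul_esymmEval_eq`).

Both sides are affine in `z`, and no relation among finitely many `e_n` survives for large `N`.
Agreement at all large integers `z = N` therefore gives agreement for every `z`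
(`ofElem_diffOp_of_ofElem_eq_schurC`). Existence follows because `ofElem` is bijective, by the
fundamental theorem in `N` variables together with stability; uniqueness follows because Schur
functions span (`span_schurC`). -/

namespace LaguerreSym

open MvPolynomial

/-! ### Derivatives and carré du champ of elementary symmetric polynomials -/

section ElementaryOnFinset

variable {σ R : Type*} [CommRing R]

/-- The elementary symmetric polynomial of degree `k` in the variables indexed by `s`. -/
noncomputable def esymmOn (R : Type*) [CommRing R] (s : Finset σ) (k : ℕ) : MvPolynomial σ R :=
  ∑ t ∈ s.powersetCard k, ∏ i ∈ t, X i

theorem esymm_eq_esymmOn [Fintype σ] (k : ℕ) : esymm σ R k = esymmOn R Finset.univ k := rfl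

theorem esymmOn_zero (s : Finset σ) : esymmOn R s 0 = 1 := by
  simp [esymmOn]

section

variable [Fintype σ]

/-- The carré du champ `∑ xᵢ ∂ᵢe_m ∂ᵢe_n` of two elementary symmetric polynomials. -/
noncomputable def esymmGamma (σ R : Type*) [CommRing R] [Fintype σ] (m n : ℕ) : MvPolynomial σ R :=
  ∑ i : σ, X i * pderiv i (esymm σ R m) * pderiv i (esymm σ R n)

theorem esymmGamma_comm (m n : ℕ) : esymmGamma σ R m n = esymmGamma σ R n m :=
  Finset.sum_congr rfl fun _ _ => by ring

theorem esymmGamma_zero_right (m : ℕ) : esymmGamma σ R m 0 = 0 := by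
  simp [esymmGamma]

end

variable [DecidableEq σ]

theorem esymmOn_insert {s : Finset σ} {i : σ} (hi : i ∉ s) (k : ℕ) :
    esymmOn R (insert i s) (k + 1) = esymmOn R s (k + 1) + X i * esymmOn R s k := by
  rw [esymmOn, Finset.powersetCard_succ_insert hi, Finset.sum_union, esymmOn, esymmOn,
    Finset.mul_sum, Finset.sum_image]
  · congr 1
    refine Finset.sum_congr rfl fun t ht => ?_
    rw [Finset.prod_insert fun h => hi ((Finset.mem_powersetCard.mp ht).1 h)]
  · intro t ht u hu h
    have ht' : i ∉ t := fun h => hi ((Finset.mem_powersetCard.mp ht).1 h)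
    have hu' : i ∉ u := fun h => hi ((Finset.mem_powersetCard.mp hu).1 h)
    rw [← Finset.erase_insert ht', ← Finset.erase_insert hu', h]
  · rw [Finset.disjoint_left]
    intro t ht hu
    obtain ⟨u, -, rfl⟩ := Finset.mem_image.mp hu
    exact hi ((Finset.mem_powersetCard.mp ht).1 (Finset.mem_insert_self _ _))

theorem esymmOn_eq_erase {s : Finset σ} {i : σ} (hi : i ∈ s) (k : ℕ) :
    esymmOn R s (k + 1) = esymmOn R (s.erase i) (k + 1) + X i * esymmOn R (s.erase i) k := by
  rw [← esymmOn_insert (Finset.notMem_erase i s), Finset.insert_erase hi]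

theorem pderiv_esymmOn_of_notMem {s : Finset σ} {i : σ} (hi : i ∉ s) (k : ℕ) :
    pderiv i (esymmOn R s k) = 0 := by
  refine pderiv_eq_zero_of_notMem_vars fun h => ?_
  rw [esymmOn] at h
  obtain ⟨t, ht, h⟩ := Finset.mem_biUnion.mp (vars_sum_subset _ _ h)
  obtain ⟨j, hj, h⟩ := Finset.mem_biUnion.mp (vars_prod _ h)
  rcases subsingleton_or_nontrivial R with hR | hR
  · simp [Subsingleton.elim (X j : MvPolynomial σ R) 0] at h
  · rw [vars_X, Finset.mem_singleton] at h
    exact hi (h ▸ (Finset.mem_powersetCard.mp ht).1 hj)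

theorem pderiv_esymmOn {s : Finset σ} {i : σ} (hi : i ∈ s) (k : ℕ) :
    pderiv i (esymmOn R s (k + 1)) = esymmOn R (s.erase i) k := by
  rw [esymmOn_eq_erase hi, map_add, Derivation.leibniz,
    pderiv_esymmOn_of_notMem (Finset.notMem_erase i s),
    pderiv_esymmOn_of_notMem (Finset.notMem_erase i s), pderiv_X_self]
  simp

theorem pderiv_pderiv_esymmOn (s : Finset σ) (i : σ) (k : ℕ) :
    pderiv i (pderiv i (esymmOn R s k)) = 0 := by
  by_cases hi : i ∈ s
  · cases k with
    | zero => simp [esymmOn_zero]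
    | succ k => rw [pderiv_esymmOn hi, pderiv_esymmOn_of_notMem (Finset.notMem_erase i s)]
  · rw [pderiv_esymmOn_of_notMem hi, map_zero]

/-- Double counting: a `k`-subset `t` of `s` survives the deletion of `i` exactly for the `|s| - k`
indices `i` outside `t`. -/
theorem sum_esymmOn_erase (s : Finset σ) (k : ℕ) :
    ∑ i ∈ s, esymmOn R (s.erase i) k = ((s.card : MvPolynomial σ R) - k) * esymmOn R s k := by
  simp only [esymmOn]
  rw [Finset.sum_comm' (t' := s.powersetCard k) (s' := fun t => s \ t)]
  · rw [Finset.mul_sum]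
    refine Finset.sum_congr rfl fun t ht => ?_
    obtain ⟨h1, h2⟩ := Finset.mem_powersetCard.mp ht
    rw [Finset.sum_const, nsmul_eq_mul, Finset.card_sdiff_of_subset h1,
      Nat.cast_sub (Finset.card_le_card h1), h2]
  · intro i t
    simp only [Finset.mem_powersetCard, Finset.mem_sdiff, Finset.subset_erase]
    tauto

variable [Fintype σ]

/-- Let `E_k` be `e_k` without the variable `xᵢ`, so that `∂ᵢe_{k+1} = E_k` and `xᵢ E_k = e_{k+1} -
E_{k+1}`. Absorbing `xᵢ` into the first factor on the left, and into the second factor on the right,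
leaves the same sum of `E_{m+1} E_n` on both sides. What remains is linear in the `E_k` and is
evaluated by `sum_esymmOn_erase`. -/
theorem esymmGamma_eq_add (m n : ℕ) : esymmGamma σ R (m + 1) (n + 1) =
    esymmGamma σ R (m + 2) n +
      ((m : MvPolynomial σ R) + 1 - n) * (esymm σ R (m + 1) * esymm σ R n) := by
  have key (k : ℕ) (i : σ) := esymmOn_eq_erase (R := R) (Finset.mem_univ i) k
  have hsum (k : ℕ) := sum_esymmOn_erase (R := R) (Finset.univ : Finset σ) k
  have h1 : esymmGamma σ R (m + 1) (n + 1) =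
      (((Fintype.card σ : MvPolynomial σ R)) - n) * (esymm σ R (m + 1) * esymm σ R n) -
        ∑ i : σ, esymmOn R (Finset.univ.erase i) (m + 1) * esymmOn R (Finset.univ.erase i) n := by
    have : (((Fintype.card σ : MvPolynomial σ R)) - n) * (esymm σ R (m + 1) * esymm σ R n) =
        ∑ i : σ, esymm σ R (m + 1) * esymmOn R (Finset.univ.erase i) n := by
      rw [← Finset.mul_sum, hsum, Finset.card_univ, esymm_eq_esymmOn, esymm_eq_esymmOn]
      ring
    rw [this, ← Finset.sum_sub_distrib, esymmGamma]
    refine Finset.sum_congr rfl fun i _ => ?_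
    simp only [esymm_eq_esymmOn, pderiv_esymmOn (Finset.mem_univ i)]
    rw [key]
    ring
  have h2 : esymmGamma σ R (m + 2) n =
      (((Fintype.card σ : MvPolynomial σ R)) - (m + 1)) * (esymm σ R (m + 1) * esymm σ R n) -
        ∑ i : σ, esymmOn R (Finset.univ.erase i) (m + 1) * esymmOn R (Finset.univ.erase i) n := by
    have : (((Fintype.card σ : MvPolynomial σ R)) - (m + 1)) *
        (esymm σ R (m + 1) * esymm σ R n) =
        ∑ i : σ, esymmOn R (Finset.univ.erase i) (m + 1) * esymm σ R n := by
      rw [← Finset.sum_mul, hsum, Finset.card_univ, esymm_eq_esymmOn, esymm_eq_esymmOn]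
      push_cast
      ring
    rw [this, ← Finset.sum_sub_distrib, esymmGamma]
    refine Finset.sum_congr rfl fun i _ => ?_
    cases n with
    | zero => simp [esymm_eq_esymmOn, esymmOn_zero]
    | succ n =>
      simp only [esymm_eq_esymmOn, pderiv_esymmOn (Finset.mem_univ i)]
      rw [key]
      ring
  rw [h1, h2]
  ring

/-- Iterating `esymmGamma_eq_add` moves degree from the second index to the first until the second
is `0`, where the carré du champ vanishes. This produces the second-order coefficients. -/
theorem esymmGamma_eq_sum (m n : ℕ) : esymmGamma σ R (m + 1) n =
    ∑ k ∈ Finset.range n, ((m : MvPolynomial σ R) + n - 2 * k) *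
      (esymm σ R (m + n - k) * esymm σ R k) := by
  induction n generalizing m with
  | zero => simp [esymmGamma_zero_right]
  | succ n ih =>
    rw [esymmGamma_eq_add, ih, Finset.sum_range_succ]
    refine congrArg₂ (· + ·) ?_ ?_
    · refine Finset.sum_congr rfl fun k _ => ?_
      rw [show m + 1 + n - k = m + (n + 1) - k by omega]
      push_cast
      ring
    · rw [show m + (n + 1) - n = m + 1 by omega]
      push_cast
      ring

end ElementaryOnFinset

/-! ### The Laguerre operator in `N` variables, written in elementary symmetric polynomials -/

section LaguerreInVariables

/-- A logarithmic derivative without division; applied twice to the double product defining the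
Vandermonde. -/
theorem derivation_prod {R A ι : Type*} [CommRing R] [CommRing A] [Algebra R A]
    (D : Derivation R A A) (s : Finset ι) (p q : ι → A) (h : ∀ i ∈ s, D (p i) = p i * q i) :
    D (∏ i ∈ s, p i) = (∏ i ∈ s, p i) * ∑ i ∈ s, q i := by
  classical
  induction s using Finset.induction_on with
  | empty => simp
  | insert i s hi ih =>
    rw [Finset.prod_insert hi, Finset.sum_insert hi, Derivation.leibniz,
      h i (Finset.mem_insert_self i s), ih fun j hj => h j (Finset.mem_insert_of_mem hj)]
    simp only [smul_eq_mul]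
    ring

/-- Chain rule. The set `T` depends on `g` and `D` only, so one `T` serves `P` and all its
derivatives. -/
theorem derivation_aeval {R A τ : Type*} [CommRing R] [CommRing A] [Algebra R A]
    (D : Derivation R A A) (g : τ → A) (T : Finset τ) (hT : ∀ n ∉ T, D (g n) = 0)
    (P : MvPolynomial τ R) :
    D (aeval g P) = ∑ n ∈ T, aeval g (pderiv n P) * D (g n) := by
  classical
  induction P using MvPolynomial.induction_on with
  | C a => simp
  | add p q hp hq => simp only [map_add, hp, hq, add_mul, Finset.sum_add_distrib]
  | mul_X p n hp =>
    simp only [map_mul, Derivation.leibniz, hp, aeval_X, smul_eq_mul, map_add, pderiv_X, add_mul,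
      Finset.sum_add_distrib, Finset.mul_sum]
    refine congrArg₂ (· + ·) ?_ (Finset.sum_congr rfl fun m _ => by ring)
    by_cases hn : n ∈ T
    · rw [Finset.sum_eq_single n]
      · simp
      · intro m _ hm
        simp [hm]
      · exact fun h => absurd hn h
    · rw [hT n hn, mul_zero, Finset.sum_eq_zero]
      intro m hm
      have : m ≠ n := fun h => hn (h ▸ hm)
      simp [this]

variable (R : Type*) [CommRing R] (N : ℕ)

theorem sum_X_mul_pderiv_esymm (n : ℕ) :
    ∑ i, X i * pderiv i (esymm (Fin N) R n) = n * esymm (Fin N) R n := by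
  cases n with
  | zero => simp
  | succ n =>
    -- Since `∂ᵢe_1 = 1`, Euler's identity is the carré du champ of `e_{n+1}` with `e_1`.
    have h := esymmGamma_eq_sum (σ := Fin N) (R := R) n 1
    rw [Finset.sum_range_one, esymmGamma] at h
    simp only [esymm_one, map_sum, pderiv_X, esymm_zero] at h
    simp only [Finset.sum_pi_single', Finset.mem_univ, if_true, mul_one,
      Nat.sub_zero] at h
    rw [h]
    push_cast
    ring

theorem sum_pderiv_esymm_succ (n : ℕ) :
    ∑ i, pderiv i (esymm (Fin N) R (n + 1)) = ((N : MvPolynomial (Fin N) R) - n) *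
      esymm (Fin N) R n := by
  have h := sum_esymmOn_erase (R := R) (Finset.univ : Finset (Fin N)) n
  rw [Finset.card_univ, Fintype.card_fin] at h
  rw [esymm_eq_esymmOn (k := n), ← h]
  exact Finset.sum_congr rfl fun i _ => by
    rw [esymm_eq_esymmOn, pderiv_esymmOn (Finset.mem_univ i)]

/-- The Vandermonde determinant `∏_{i < j} (xᵢ - xⱼ)` over a general ring. -/
noncomputable def vandermondeOver : MvPolynomial (Fin N) R :=
  ∏ i : Fin N, ∏ j ∈ Finset.Ioi i, (X i - X j)

variable {R N}

/-- After both variables are split off, the mixed terms containing `xᵢ xⱼ` cancel. This makes each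
Vandermonde factor an eigenvector, up to a polynomial multiplier, of the derivation used next. -/
theorem X_mul_esymmOn_erase_sub {i j : Fin N} (hij : i ≠ j) (k : ℕ) :
    X i * esymmOn R (Finset.univ.erase i) k - X j * esymmOn R (Finset.univ.erase j) k =
      (X i - X j) * esymmOn R ((Finset.univ.erase i).erase j) k := by
  cases k with
  | zero => simp [esymmOn_zero]
  | succ k =>
    have hi : i ∈ Finset.univ.erase j := Finset.mem_erase.mpr ⟨hij, Finset.mem_univ i⟩
    have hj : j ∈ Finset.univ.erase i := Finset.mem_erase.mpr ⟨hij.symm, Finset.mem_univ j⟩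
    rw [esymmOn_eq_erase hi, esymmOn_eq_erase hj, Finset.erase_right_comm (a := j)]
    ring

theorem sum_sum_Ioi_add_self {A : Type*} [AddCommMonoid A] (f : Fin N → Fin N → A)
    (hf : ∀ i j, f i j = f j i) :
    ∑ i, ∑ j ∈ Finset.Ioi i, f i j + ∑ i, ∑ j ∈ Finset.Ioi i, f i j =
      ∑ i, ∑ j ∈ Finset.univ.erase i, f i j := by
  have h : ∑ i, ∑ j ∈ Finset.Ioi i, f i j = ∑ i, ∑ j ∈ Finset.Iio i, f i j := by
    rw [Finset.sum_comm' (t' := Finset.univ) (s' := fun j => Finset.Iio j)]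
    · exact Finset.sum_congr rfl fun i _ => Finset.sum_congr rfl fun j _ => hf _ _
    · intro i j
      simp
  nth_rewrite 2 [h]
  rw [← Finset.sum_add_distrib]
  refine Finset.sum_congr rfl fun i _ => ?_
  rw [← Finset.sum_union]
  · congr 1
    ext j
    simp only [Finset.mem_union, Finset.mem_Ioi, Finset.mem_Iio, Finset.mem_erase,
      Finset.mem_univ, and_true]
    exact ⟨fun h => h.elim (fun h => h.ne') fun h => h.ne, fun h => (lt_or_gt_of_ne h).symm⟩
  · rw [Finset.disjoint_left]
    intro j hj hj'
    exact lt_asymm (Finset.mem_Ioi.mp hj) (Finset.mem_Iio.mp hj')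

/-- The derivation `∑ xᵢ ∂ᵢe_{k+1} ∂ᵢ` multiplies `xᵢ - xⱼ` by `e_k` of the other variables, hence
multiplies `V` by the sum of these over pairs. The factor `2` passes to ordered pairs, and
`sum_esymmOn_erase` applies twice. -/
theorem two_mul_sum_pderiv_vandermonde (k : ℕ) :
    2 * ∑ i, X i * pderiv i (esymm (Fin N) R (k + 1)) * pderiv i (vandermondeOver R N) =
      vandermondeOver R N * (((N : MvPolynomial (Fin N) R) - k) * ((N - 1 - k) *
        esymm (Fin N) R k)) := by
  let D : Derivation R (MvPolynomial (Fin N) R) (MvPolynomial (Fin N) R) :=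
    ∑ i, (X i * pderiv i (esymm (Fin N) R (k + 1))) • pderiv i
  have hD (f : MvPolynomial (Fin N) R) :
      D f = ∑ i, X i * pderiv i (esymm (Fin N) R (k + 1)) * pderiv i f := by
    have := map_sum (Derivation.coeFnAddMonoidHom (R := R) (A := MvPolynomial (Fin N) R)
      (M := MvPolynomial (Fin N) R)) (fun i => (X i * pderiv i (esymm (Fin N) R (k + 1))) •
        pderiv i) Finset.univ
    exact (congrFun this f).trans (Finset.sum_apply _ _ _)
  have hX (i : Fin N) : D (X i) = X i * esymmOn R (Finset.univ.erase i) k := by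
    rw [hD, Finset.sum_eq_single i, pderiv_X_self, esymm_eq_esymmOn,
      pderiv_esymmOn (Finset.mem_univ i), mul_one]
    · intro j _ hj
      rw [pderiv_X_of_ne hj.symm, mul_zero]
    · exact fun h => absurd (Finset.mem_univ i) h
  have hV : D (vandermondeOver R N) = vandermondeOver R N *
      ∑ i, ∑ j ∈ Finset.Ioi i, esymmOn R ((Finset.univ.erase i).erase j) k := by
    refine derivation_prod D _ _ _ fun i _ => derivation_prod D _ _ _ fun j hj => ?_
    rw [map_sub, hX, hX, X_mul_esymmOn_erase_sub (Finset.mem_Ioi.mp hj).ne]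
  rw [← hD, hV, two_mul, ← mul_add,
    sum_sum_Ioi_add_self _ fun i j => by rw [Finset.erase_right_comm]]
  congr 1
  have h1 (i : Fin N) := sum_esymmOn_erase (R := R) (Finset.univ.erase i) k
  have h2 := sum_esymmOn_erase (R := R) (Finset.univ : Finset (Fin N)) k
  simp_rw [h1, Finset.card_erase_of_mem (Finset.mem_univ _), Finset.card_univ, Fintype.card_fin]
  rw [← Finset.mul_sum, h2, esymm_eq_esymmOn, Finset.card_univ, Fintype.card_fin]
  -- The cardinality of the erased set is the truncated `N - 1`, which differs from the ring element
  -- at `N = 0`.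
  rcases N with _ | N
  · rcases k with _ | k
    · simp
    · simp [esymmOn, Finset.powersetCard_eq_empty.mpr (show (∅ : Finset (Fin 0)).card < k + 1 by simp)]
  · push_cast
    ring

/-- The `N`-variate operator `∑ xᵢ ∂ᵢ² + (b - xᵢ) ∂ᵢ`, a sum of one-variable Laguerre operators. -/
noncomputable def laguerreSum (b : R) : MvPolynomial (Fin N) R →ₗ[R] MvPolynomial (Fin N) R where
  toFun f := ∑ i, (X i * pderiv i (pderiv i f) + (C b - X i) * pderiv i f)
  map_add' f g := by
    rw [← Finset.sum_add_distrib]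
    exact Finset.sum_congr rfl fun i _ => by simp only [map_add]; ring
  map_smul' c f := by
    rw [RingHom.id_apply, Finset.smul_sum]
    exact Finset.sum_congr rfl fun i _ => by simp only [Derivation.map_smul, smul_add, mul_smul_comm]

theorem laguerreSum_apply (b : R) (f : MvPolynomial (Fin N) R) :
    laguerreSum b f = ∑ i, (X i * pderiv i (pderiv i f) + (C b - X i) * pderiv i f) := rfl

theorem laguerreSum_mul (b : R) (f g : MvPolynomial (Fin N) R) :
    laguerreSum b (f * g) = laguerreSum b f * g + f * laguerreSum b g +
      2 * ∑ i, X i * pderiv i g * pderiv i f := by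
  simp only [laguerreSum_apply, Finset.sum_mul, Finset.mul_sum]
  rw [← Finset.sum_add_distrib, ← Finset.sum_add_distrib]
  refine Finset.sum_congr rfl fun i _ => ?_
  simp only [Derivation.leibniz, smul_eq_mul, map_add]
  ring

variable (R N) in
/-- The algebra morphism `R[e₁, e₂, …] → R[x₁, …, x_N]` sending each variable `e_n` to the
elementary symmetric polynomial of degree `n`. -/
noncomputable def esymmEval : MvPolynomial ℕ+ R →ₐ[R] MvPolynomial (Fin N) R :=
  aeval fun n : ℕ+ => esymm (Fin N) R n

theorem pderiv_esymmEval (T : Finset ℕ+) (hT : ∀ n ∉ T, esymm (Fin N) R n = 0)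
    (P : MvPolynomial ℕ+ R) (i : Fin N) : pderiv i (esymmEval R N P) =
      ∑ n ∈ T, esymmEval R N (pderiv n P) * pderiv i (esymm (Fin N) R n) :=
  derivation_aeval (pderiv i) _ T (fun n hn => by rw [hT n hn, map_zero]) P

/-- Each `e_n` has degree at most one in every variable, so `∂ᵢ²e_n = 0`. Hence second derivatives
in the `e_n` enter only through `esymmGamma`, and first derivatives only through the drift. -/
theorem laguerreSum_esymmEval (b : R) (T : Finset ℕ+) (hT : ∀ n ∉ T, esymm (Fin N) R n = 0)
    (P : MvPolynomial ℕ+ R) :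
    laguerreSum b (esymmEval R N P) =
      ∑ m ∈ T, ∑ n ∈ T, esymmEval R N (pderiv (m : ℕ+) (pderiv n P)) * esymmGamma (Fin N) R m n +
      ∑ n ∈ T, esymmEval R N (pderiv n P) * (C b *
        (((N : MvPolynomial (Fin N) R) + 1 - ((n : ℕ) : MvPolynomial (Fin N) R)) *
        esymm (Fin N) R (n - 1)) -
        ((n : ℕ) : MvPolynomial (Fin N) R) * esymm (Fin N) R n) := by
  have hc (i : Fin N) (Q : MvPolynomial ℕ+ R) := pderiv_esymmEval T hT Q i
  have h0 (i : Fin N) (n : ℕ) : pderiv i (pderiv i (esymm (Fin N) R n)) = 0 := by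
    rw [esymm_eq_esymmOn, pderiv_pderiv_esymmOn]
  have h1 (i : Fin N) : pderiv i (pderiv i (esymmEval R N P)) = ∑ n ∈ T, ∑ m ∈ T,
      esymmEval R N (pderiv (m : ℕ+) (pderiv n P)) * pderiv i (esymm (Fin N) R m) *
        pderiv i (esymm (Fin N) R n) := by
    rw [hc i P, map_sum]
    refine Finset.sum_congr rfl fun n _ => ?_
    rw [Derivation.leibniz, h0, hc i, smul_zero, zero_add, smul_eq_mul, mul_comm, Finset.sum_mul]
  rw [laguerreSum_apply, Finset.sum_add_distrib]
  refine congrArg₂ (· + ·) ?_ ?_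
  · simp_rw [h1, esymmGamma, Finset.mul_sum]
    rw [Finset.sum_comm]
    rw [Finset.sum_comm (s := T) (t := T)]
    refine Finset.sum_congr rfl fun n _ => ?_
    rw [Finset.sum_comm]
    refine Finset.sum_congr rfl fun m _ => Finset.sum_congr rfl fun i _ => ?_
    ring
  · simp_rw [hc _ P, Finset.mul_sum]
    rw [Finset.sum_comm]
    refine Finset.sum_congr rfl fun n _ => ?_
    have e1 := sum_X_mul_pderiv_esymm R N n
    have e2 := sum_pderiv_esymm_succ R N (n - 1)
    have hn : ((n : ℕ) - 1 + 1) = n := Nat.sub_add_cancel n.pos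
    have hn' : (((n : ℕ) - 1 : ℕ) : MvPolynomial (Fin N) R) = (n : ℕ) - 1 := by
      rw [Nat.cast_sub n.pos, Nat.cast_one]
    rw [hn, hn'] at e2
    have e2' : ((N : MvPolynomial (Fin N) R) + 1 - (n : ℕ)) * esymm (Fin N) R (n - 1) =
      ∑ i, pderiv i (esymm (Fin N) R n) := by rw [e2]; ring
    rw [e2', ← e1, Finset.mul_sum, ← Finset.sum_sub_distrib, Finset.mul_sum]
    refine Finset.sum_congr rfl fun i _ => ?_
    ring

/-- The cross term with `V` adds `(N + 1 - n) * (N - n) * e_{n-1}` to the drift `b * (N + 1 - n) *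
e_{n-1}`, which completes the product of two linear factors. -/
theorem laguerreSum_vandermonde_mul_esymmEval (b : R) (T : Finset ℕ+)
    (hT : ∀ n ∉ T, esymm (Fin N) R n = 0) (P : MvPolynomial ℕ+ R) :
    laguerreSum b (vandermondeOver R N * esymmEval R N P) =
      laguerreSum b (vandermondeOver R N) * esymmEval R N P +
      vandermondeOver R N *
      (∑ m ∈ T, ∑ n ∈ T, esymmEval R N (pderiv (m : ℕ+) (pderiv n P)) * esymmGamma (Fin N) R m n +
      ∑ n ∈ T, esymmEval R N (pderiv n P) *
        (((N : MvPolynomial (Fin N) R) + 1 - ((n : ℕ) : MvPolynomial (Fin N) R)) *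
        (C b + (N : MvPolynomial (Fin N) R) - ((n : ℕ) : MvPolynomial (Fin N) R)) *
          esymm (Fin N) R (n - 1) -
        ((n : ℕ) : MvPolynomial (Fin N) R) * esymm (Fin N) R n)) := by
  have hc (i : Fin N) := pderiv_esymmEval T hT P i
  rw [laguerreSum_mul, laguerreSum_esymmEval b T hT, add_assoc]
  congr 1
  rw [mul_add, mul_add, add_assoc]
  congr 1
  have h1 : 2 * ∑ i, X i * pderiv i (esymmEval R N P) * pderiv i (vandermondeOver R N) =
      ∑ n ∈ T, esymmEval R N (pderiv n P) * (2 * ∑ i, X i * pderiv i (esymm (Fin N) R n) *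
        pderiv i (vandermondeOver R N)) := by
    simp_rw [hc, Finset.mul_sum, Finset.sum_mul, Finset.mul_sum]
    rw [Finset.sum_comm]
    refine Finset.sum_congr rfl fun n _ => Finset.sum_congr rfl fun i _ => ?_
    ring
  rw [h1, Finset.mul_sum, Finset.mul_sum, ← Finset.sum_add_distrib]
  refine Finset.sum_congr rfl fun n _ => ?_
  have e2 := two_mul_sum_pderiv_vandermonde (R := R) (N := N) (n - 1)
  have hn : ((n : ℕ) - 1 + 1) = n := Nat.sub_add_cancel n.pos
  have hn' : (((n : ℕ) - 1 : ℕ) : MvPolynomial (Fin N) R) = (n : ℕ) - 1 := by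
    rw [Nat.cast_sub n.pos, Nat.cast_one]
  rw [hn, hn'] at e2
  rw [e2]
  ring

end LaguerreInVariables

/-! ### Action of the Laguerre operator on alternants -/

section Alternants

/-- The alternant `det [x_j ^ l_i]` with an arbitrary exponent vector `l`, over a general ring. -/
noncomputable def altOver (R : Type*) [CommRing R] {N : ℕ} (l : Fin N → ℕ) :
    MvPolynomial (Fin N) R :=
  Matrix.det (Matrix.of fun i j : Fin N => (X j : MvPolynomial (Fin N) R) ^ l i)

variable {R : Type*} [CommRing R] {N : ℕ}

theorem prod_univ_X_pow_eq_monomial (d : Fin N → ℕ) :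
    ∏ j, (X j : MvPolynomial (Fin N) R) ^ d j = monomial (Finsupp.equivFunOnFinite.symm d) 1 := by
  rw [monomial_eq, Finsupp.prod_fintype _ _ fun _ => pow_zero _]
  simp

theorem pderiv_prod_X_pow (d : Fin N → ℕ) (i : Fin N) :
    pderiv i (∏ j, (X j : MvPolynomial (Fin N) R) ^ d j) =
      C (d i : R) * ∏ j, X j ^ Function.update d i (d i - 1) j := by
  have hs : Finsupp.equivFunOnFinite.symm d - Finsupp.single i 1 =
      Finsupp.equivFunOnFinite.symm (Function.update d i (d i - 1)) := by
    ext j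
    by_cases h : j = i
    · subst h; simp
    · simp [Function.update_of_ne h, Ne.symm h]
  rw [prod_univ_X_pow_eq_monomial, prod_univ_X_pow_eq_monomial, pderiv_monomial, C_mul_monomial, hs]
  simp

theorem X_mul_C_mul_prod_X_pow_update (d : Fin N → ℕ) (i : Fin N) :
    X i * (C (d i : R) * ∏ j, X j ^ Function.update d i (d i - 1) j) =
      C (d i : R) * ∏ j, X j ^ d j := by
  rw [← Finset.mul_prod_erase _ _ (Finset.mem_univ i),
    ← Finset.mul_prod_erase _ (fun j => X j ^ d j) (Finset.mem_univ i), Function.update_self]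
  have h : ∏ j ∈ Finset.univ.erase i, (X j : MvPolynomial (Fin N) R) ^
      Function.update d i (d i - 1) j = ∏ j ∈ Finset.univ.erase i, X j ^ d j :=
    Finset.prod_congr rfl fun j hj => by rw [Function.update_of_ne (Finset.ne_of_mem_erase hj)]
  rw [h]
  rcases hd : d i with _ | n
  · simp
  · rw [Nat.add_sub_cancel, pow_succ]
    ring

theorem laguerreSum_prod_X_pow (b : R) (d : Fin N → ℕ) :
    laguerreSum b (∏ j, (X j : MvPolynomial (Fin N) R) ^ d j) =
      ∑ i, (C ((d i : R) * (d i - 1 + b)) * ∏ j, X j ^ Function.update d i (d i - 1) j -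
        C (d i : R) * ∏ j, X j ^ d j) := by
  rw [laguerreSum_apply]
  refine Finset.sum_congr rfl fun i _ => ?_
  have h := X_mul_C_mul_prod_X_pow_update (R := R) (Function.update d i (d i - 1)) i
  have h' := X_mul_C_mul_prod_X_pow_update (R := R) d i
  rw [pderiv_prod_X_pow, pderiv_C_mul, pderiv_prod_X_pow, ← smul_eq_C_mul, mul_smul_comm, h,
    Function.update_self, sub_mul, h', smul_eq_C_mul]
  -- The truncated exponent `d i - 1` is harmless: at `d i = 0` its coefficient vanishes.
  rcases hd : d i with _ | n
  · simp
  · simp only [Nat.add_sub_cancel, map_mul, map_sub, map_add, Nat.cast_add, Nat.cast_one, map_one]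
    ring

theorem altOver_eq_sum (l : Fin N → ℕ) :
    altOver R l = ∑ σ : Equiv.Perm (Fin N), Equiv.Perm.sign σ • ∏ i, X i ^ l (σ i) := by
  rw [altOver, Matrix.det_apply]
  rfl

/-- All variables are treated alike, so in each term of the determinant the effect on an exponent
depends only on its value. Regrouping by row gives alternants with a single row lowered. -/
theorem laguerreSum_altOver (b : R) (l : Fin N → ℕ) :
    laguerreSum b (altOver R l) =
      ∑ i, (C ((l i : R) * (l i - 1 + b)) * altOver R (Function.update l i (l i - 1)) -
        C (l i : R) * altOver R l) := by
  have key (σ : Equiv.Perm (Fin N)) := laguerreSum_prod_X_pow b (fun i => l (σ i))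
  simp only [altOver_eq_sum, map_sum, Finset.mul_sum, ← Finset.sum_sub_distrib]
  rw [Finset.sum_comm]
  refine Finset.sum_congr rfl fun σ _ => ?_
  rw [Units.smul_def, map_zsmul, key, Finset.smul_sum]
  symm
  -- In the term of `σ`, the variable `i` carries the exponent of row `σ i`; this reindexes
  -- variables by rows.
  rw [← Equiv.sum_comp σ]
  refine Finset.sum_congr rfl fun i _ => ?_
  have h (j : Fin N) : Function.update (fun i => l (σ i)) i (l (σ i) - 1) j =
      Function.update l (σ i) (l (σ i) - 1) (σ j) := by
    by_cases hj : j = i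
    · subst hj; simp
    · rw [Function.update_of_ne hj, Function.update_of_ne fun h => hj (σ.injective h)]
  simp only [h, smul_sub, Units.smul_def, mul_smul_comm]

theorem altOver_eq_zero {l : Fin N → ℕ} {i j : Fin N} (hij : i ≠ j) (h : l i = l j) :
    altOver R l = 0 :=
  Matrix.det_zero_of_row_eq hij (by ext1 k; simp [h])

theorem altOver_comp_perm (l : Fin N → ℕ) (σ : Equiv.Perm (Fin N)) :
    altOver R (l ∘ σ) = (Equiv.Perm.sign σ : ℤ) • altOver R l := by
  have h := Matrix.det_permute σ
    (Matrix.of fun i j : Fin N => (X j : MvPolynomial (Fin N) R) ^ l i)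
  rw [zsmul_eq_mul]
  exact h

end Alternants

/-! ### Corner boxes and lowered exponents -/

section Corners

theorem mem_corners_iff {ν : YoungDiagram} {c : ℕ × ℕ} :
    c ∈ corners ν ↔ ν.rowLen c.1 = c.2 + 1 ∧ ν.rowLen (c.1 + 1) ≤ c.2 := by
  classical
  obtain ⟨i, j⟩ := c
  simp only [corners, Finset.mem_filter, YoungDiagram.mem_cells]
  constructor
  · rintro ⟨hc, hl⟩
    have h1 : (i, j + 1) ∉ ν := fun h => by
      have : (i, j + 1) ∈ (↑(ν.cells.erase (i, j)) : Set (ℕ × ℕ)) := by simpa using h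
      simpa using hl (show (i, j) ≤ (i, j + 1) from ⟨le_rfl, Nat.le_succ j⟩) this
    have h2 : (i + 1, j) ∉ ν := fun h => by
      have : (i + 1, j) ∈ (↑(ν.cells.erase (i, j)) : Set (ℕ × ℕ)) := by simpa using h
      simpa using hl (show (i, j) ≤ (i + 1, j) from ⟨Nat.le_succ i, le_rfl⟩) this
    rw [YoungDiagram.mem_iff_lt_rowLen] at hc h1 h2
    omega
  · rintro ⟨h1, h2⟩
    refine ⟨YoungDiagram.mem_iff_lt_rowLen.mpr (by omega), ?_⟩
    rintro ⟨a, a'⟩ ⟨b, b'⟩ ⟨hb, hb'⟩ ha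
    dsimp only at hb hb'
    simp only [Finset.coe_erase, Set.mem_sdiff, Finset.mem_coe, YoungDiagram.mem_cells,
      Set.mem_singleton_iff, Prod.mk.injEq] at ha ⊢
    refine ⟨ν.up_left_mem hb hb' ha.1, ?_⟩
    rintro ⟨rfl, rfl⟩
    rcases hb.eq_or_lt with h | h
    · subst h
      have := YoungDiagram.mem_iff_lt_rowLen.mp ha.1
      exact ha.2 ⟨rfl, by omega⟩
    · have := YoungDiagram.mem_iff_lt_rowLen.mp ha.1
      have := ν.rowLen_anti (b + 1) a h
      omega

theorem rowLen_removeCorner (ν : YoungDiagram) (c : {c // c ∈ corners ν}) (k : ℕ) :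
    (removeCorner ν c).rowLen k = if k = c.1.1 then ν.rowLen k - 1 else ν.rowLen k := by
  obtain ⟨⟨i, j⟩, hc⟩ := c
  have h := (mem_corners_iff.mp hc).1
  dsimp only at h ⊢
  refine eq_of_forall_lt_iff fun m => ?_
  rw [← YoungDiagram.mem_iff_lt_rowLen]
  have : (k, m) ∈ removeCorner ν ⟨(i, j), hc⟩ ↔ (k, m) ≠ (i, j) ∧ (k, m) ∈ ν := by
    rw [← YoungDiagram.mem_cells, removeCorner, Finset.mem_erase, YoungDiagram.mem_cells]
  rw [this, YoungDiagram.mem_iff_lt_rowLen, Ne, Prod.mk.injEq]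
  split_ifs with hk
  · subst hk
    omega
  · simp [hk]

theorem removeCorner_le (ν : YoungDiagram) (c : {c // c ∈ corners ν}) : removeCorner ν c ≤ ν :=
  YoungDiagram.cells_subset_iff.mp (Finset.erase_subset _ _)

theorem colLen_mono {μ ν : YoungDiagram} (h : μ ≤ ν) (j : ℕ) : μ.colLen j ≤ ν.colLen j := by
  refine le_of_forall_lt fun i hi => ?_
  exact YoungDiagram.mem_iff_lt_colLen.mp (h (YoungDiagram.mem_iff_lt_colLen.mpr hi))

theorem sum_rowLen_eq_card {N : ℕ} {ν : YoungDiagram} (h : ν.colLen 0 ≤ N) :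
    ∑ i : Fin N, ν.rowLen i = ν.card := by
  refine le_antisymm (sum_rowLen_le N ν) ?_
  rw [Fin.sum_univ_eq_sum_range (fun i => ν.rowLen i) N]
  simp only [YoungDiagram.rowLen_eq_card]
  refine (Finset.card_le_card fun c hc => ?_).trans Finset.card_biUnion_le
  rw [Finset.mem_biUnion]
  refine ⟨c.1, ?_, YoungDiagram.mem_row_iff.mpr ⟨hc, rfl⟩⟩
  have : (c.1, 0) ∈ ν := ν.up_left_mem le_rfl (Nat.zero_le _) hc
  exact Finset.mem_range.mpr ((YoungDiagram.mem_iff_lt_colLen.mp this).trans_le h)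

/-- The exponents `ν_i + N - i` (with `i` counted from `1`) of the alternant of `ν`. -/
def rowExponent (N : ℕ) (ν : YoungDiagram) (i : Fin N) : ℕ := ν.rowLen i + (N - 1 - i)

/-- Lowering a row without a corner either makes its exponent equal to the next one, so the
alternant vanishes, or meets exponent `0`, so the coefficient does. At a corner the exponent is `N`
plus the content. -/
theorem laguerreSum_altOver_rowExponent {R : Type*} [CommRing R] {N : ℕ} (b : R)
    {ν : YoungDiagram} (h : ν.colLen 0 ≤ N) :
    laguerreSum b (altOver R (rowExponent N ν)) =
      ∑ c : {c // c ∈ corners ν}, C (((N : R) + content c) * (N + content c - 1 + b)) *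
        altOver R (rowExponent N (removeCorner ν c)) -
      C ((ν.card : R) + ∑ i : Fin N, ((N - 1 - i : ℕ) : R)) * altOver R (rowExponent N ν) := by
  rw [laguerreSum_altOver, Finset.sum_sub_distrib]
  refine congrArg₂ (· - ·) (Eq.symm ?_) ?_
  · have hN (c : {c // c ∈ corners ν}) : c.1.1 < N := by
      have := (mem_corners_iff.mp c.2).1
      by_contra hlt
      rw [rowLen_eq_zero (h.trans (not_lt.mp hlt))] at this
      omega
    refine Finset.sum_of_injOn (fun c => ⟨c.1.1, hN c⟩) ?_ (fun _ _ => Finset.mem_univ _) ?_ ?_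
    · rintro ⟨⟨i, j⟩, hc⟩ - ⟨⟨i', j'⟩, hc'⟩ - hij
      obtain rfl : i = i' := congrArg Fin.val hij
      have h1 := (mem_corners_iff.mp hc).1
      have h2 := (mem_corners_iff.mp hc').1
      obtain rfl : j = j' := by dsimp only at h1 h2; omega
      rfl
    · intro i _ hi
      have hi2 := i.2
      by_cases h0 : rowExponent N ν i = 0
      · simp [h0]
      have hcor : ν.rowLen i = ν.rowLen (i + 1) := by
        refine le_antisymm (not_lt.mp fun hlt => hi ?_) (ν.rowLen_anti _ _ (Nat.le_succ _))
        refine ⟨⟨(i, ν.rowLen i - 1), mem_corners_iff.mpr ⟨?_, ?_⟩⟩, Finset.mem_coe.mpr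
          (Finset.mem_univ _), rfl⟩ <;> dsimp only <;> omega
      by_cases hlast : (i : ℕ) + 1 < N
      · rw [altOver_eq_zero (i := i) (j := ⟨i + 1, hlast⟩) (fun h => by simp [Fin.ext_iff] at h),
          mul_zero]
        rw [Function.update_self, Function.update_of_ne fun h => by simp [Fin.ext_iff] at h]
        simp only [rowExponent]
        omega
      -- In the last row, having no corner forces length `0` and hence exponent `0`, a case already
      -- excluded.
      · rw [rowLen_eq_zero (i := i + 1) (by omega)] at hcor
        simp only [rowExponent] at h0
        omega
    · rintro ⟨⟨i, j⟩, hc⟩ -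
      have h1 := (mem_corners_iff.mp hc).1
      have hlt := hN ⟨⟨i, j⟩, hc⟩
      dsimp only at h1 hlt ⊢
      have hexp : ((rowExponent N ν ⟨i, hlt⟩ : ℕ) : R) = N + content (i, j) := by
        have : ((rowExponent N ν ⟨i, hlt⟩ : ℕ) : ℤ) = N + content (i, j) := by
          simp only [rowExponent, content]
          omega
        rw [← Int.cast_natCast, this]
        push_cast
        rfl
      rw [hexp]
      congr 2
      ext ⟨k, hk⟩
      by_cases hki : k = i
      · subst hki
        rw [Function.update_self]
        simp only [rowExponent, rowLen_removeCorner, if_true]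
        omega
      · rw [Function.update_of_ne fun h => hki (congrArg Fin.val h)]
        simp only [rowExponent, rowLen_removeCorner, if_neg hki]
  · rw [← Finset.sum_mul, ← map_sum, ← sum_rowLen_eq_card h]
    simp only [rowExponent, Nat.cast_add, Finset.sum_add_distrib, Nat.cast_sum]

end Corners

/-! ### Removal of corner boxes from complexified Schur polynomials -/

section SchurComplex

variable {N : ℕ}

theorem map_alternant (ν : YoungDiagram) :
    map (algebraMap ℝ ℂ) (alternant N ν) = altOver ℂ (rowExponent N ν) := by
  rw [alternant, RingHom.map_det, altOver]
  congr 1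
  ext1 i j
  simp [rowExponent]

theorem map_vandermondePoly :
    map (algebraMap ℝ ℂ) (vandermondePoly N) = vandermondeOver ℂ N := by
  simp [vandermondePoly, vandermondeOver, map_prod]

theorem vandermondeOver_ne_zero : vandermondeOver ℂ N ≠ 0 := by
  rw [← map_vandermondePoly, Ne, map_eq_zero_iff _ (map_injective _ (algebraMap ℝ ℂ).injective)]
  exact vandermondePoly_ne_zero N

theorem vandermondeOver_mul_map_schurPoly {ν : YoungDiagram} (h : ν.colLen 0 ≤ N) :
    vandermondeOver ℂ N * map (algebraMap ℝ ℂ) (schurPoly N ν) = altOver ℂ (rowExponent N ν) := by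
  rw [← map_vandermondePoly, ← map_mul, vandermondePoly_mul_schurPoly h, map_alternant]

/-- The Vandermonde is the alternant of the empty diagram, which has no corners, so only the
diagonal term remains. -/
theorem laguerreSum_vandermondeOver (b : ℂ) : laguerreSum b (vandermondeOver ℂ N) =
    -(C (∑ i : Fin N, ((N - 1 - i : ℕ) : ℂ)) * vandermondeOver ℂ N) := by
  have hb : (⊥ : YoungDiagram).colLen 0 ≤ N := by
    by_contra h
    exact YoungDiagram.notMem_bot (0, 0)
      (YoungDiagram.mem_iff_lt_colLen.mpr (Nat.zero_lt_of_lt (not_le.mp h)))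
  have h := laguerreSum_altOver_rowExponent b hb
  rw [← map_alternant, ← vandermondePoly_eq, map_vandermondePoly] at h
  have : IsEmpty {c // c ∈ corners (⊥ : YoungDiagram)} := ⟨fun c => by
    have := (mem_corners_iff.mp c.2).1
    rw [rowLen_bot] at this
    omega⟩
  rw [h, Finset.univ_eq_empty, Finset.sum_empty, zero_sub]
  simp [YoungDiagram.card]

/-- The radial part of the Laguerre operator in `N` variables acts on Schur polynomials by
removing corner boxes. -/
theorem laguerreSum_vandermonde_mul_schurPoly (b : ℂ) {ν : YoungDiagram} (h : ν.colLen 0 ≤ N) :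
    laguerreSum b (vandermondeOver ℂ N * map (algebraMap ℝ ℂ) (schurPoly N ν)) =
      laguerreSum b (vandermondeOver ℂ N) * map (algebraMap ℝ ℂ) (schurPoly N ν) +
      vandermondeOver ℂ N * (-(ν.card : ℂ) • map (algebraMap ℝ ℂ) (schurPoly N ν) +
        ∑ c : {c // c ∈ corners ν}, (((N : ℂ) + content c) * (N + content c - 1 + b)) •
          map (algebraMap ℝ ℂ) (schurPoly N (removeCorner ν c))) := by
  have hc (c : {c // c ∈ corners ν}) : (removeCorner ν c).colLen 0 ≤ N :=
    (colLen_mono (removeCorner_le ν c) 0).trans h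
  rw [vandermondeOver_mul_map_schurPoly h, laguerreSum_altOver_rowExponent b h,
    laguerreSum_vandermondeOver, mul_add, Finset.mul_sum, ← vandermondeOver_mul_map_schurPoly h]
  simp_rw [← fun c => vandermondeOver_mul_map_schurPoly (hc c), smul_eq_C_mul, map_add, map_neg]
  rw [sub_eq_add_neg, add_comm]
  rw [← add_assoc]
  refine congrArg₂ (· + ·) (by ring) (Finset.sum_congr rfl fun c _ => by ring)

end SchurComplex

/-! ### Symmetric functions of bounded degree are determined in finitely many variables -/

section Stability

theorem coeff_setLastZero {N : ℕ} (f : MvPolynomial (Fin (N + 1)) ℝ) (s : Fin (N + 1) →₀ ℕ)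
    (hs : s (Fin.last N) = 0) :
    coeff (Finsupp.equivFunOnFinite.symm fun i => s (Fin.castSucc i)) (setLastZero N f) =
      coeff s f := by
  induction f using MvPolynomial.induction_on' with
  | add p q hp hq => rw [map_add, coeff_add, coeff_add, hp, hq]
  | monomial u a =>
    have h : setLastZero N (monomial u a) = C a * ((∏ i : Fin N, X i ^ u (Fin.castSucc i)) *
        0 ^ u (Fin.last N)) := by
      rw [setLastZero, aeval_monomial, Finsupp.prod_fintype _ _ fun _ => pow_zero _,
        Fin.prod_univ_castSucc]
      simp [algebraMap_eq]
    rw [h, coeff_monomial]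
    by_cases hu : u (Fin.last N) = 0
    · rw [hu, pow_zero, mul_one, prod_univ_X_pow_eq_monomial, C_mul_monomial, mul_one, coeff_monomial]
      refine if_congr ?_ rfl rfl
      rw [Equiv.apply_eq_iff_eq]
      refine ⟨fun h => ?_, fun h => by rw [h]⟩
      ext i
      induction i using Fin.lastCases with
      | last => rw [hu, hs]
      | cast i => exact congrFun h i
    · rw [zero_pow hu, mul_zero, mul_zero, coeff_zero, if_neg]
      rintro rfl
      exact hu hs

/-- A symmetric polynomial of degree at most `N` in `N + 1` variables is determined by setting
the last variable to zero. -/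
theorem eq_zero_of_setLastZero {N : ℕ} {f : MvPolynomial (Fin (N + 1)) ℝ} (hf : f.IsSymmetric)
    (hd : f.totalDegree ≤ N) (h : setLastZero N f = 0) : f = 0 := by
  by_contra hne
  obtain ⟨s, hs⟩ := ne_zero_iff.mp hne
  -- A monomial missing some variable is moved by symmetry to one missing the last variable, whose
  -- coefficient survives `setLastZero`. So every monomial involves all `N + 1` variables, against
  -- the degree bound.
  have hpos (i : Fin (N + 1)) : 1 ≤ s i := by
    by_contra h0
    let σ : Equiv.Perm (Fin (N + 1)) := Equiv.swap i (Fin.last N)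
    have h1 : coeff (s.mapDomain σ) f = coeff s f := by
      conv_lhs => rw [← hf σ]
      exact coeff_rename_mapDomain σ σ.injective f s
    have h2 : s.mapDomain σ (Fin.last N) = 0 := by
      have := Finsupp.mapDomain_apply σ.injective s i
      rw [show σ i = Fin.last N from Equiv.swap_apply_left _ _] at this
      rw [this]
      omega
    rw [← h1, ← coeff_setLastZero f _ h2, h, coeff_zero] at hs
    exact hs rfl
  have h3 : (s.sum fun _ e => e) ≤ N := (le_totalDegree (mem_support_iff.mpr hs)).trans hd
  rw [Finsupp.sum_fintype _ _ fun _ => rfl] at h3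
  have h4 : ∑ _i : Fin (N + 1), 1 ≤ ∑ i, s i := Finset.sum_le_sum fun i _ => hpos i
  simp at h4
  omega

theorem Sym.eq_zero_of_apply_eq_zero {f : Sym} {d : ℕ} (hd : ∀ N, (f.1 N).totalDegree ≤ d)
    (h : f.1 d = 0) : f = 0 := by
  have hup (k : ℕ) : f.1 (d + k) = 0 := by
    induction k with
    | zero => exact h
    | succ k ih =>
      refine eq_zero_of_setLastZero (f.2.1 _) ((hd _).trans (Nat.le_add_right _ _)) ?_
      exact (f.2.2.1 (d + k)).trans ih
  have hdown (k : ℕ) : ∀ N, f.1 (N + k) = 0 → f.1 N = 0 := by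
    induction k with
    | zero => exact fun N h => h
    | succ k ih => exact fun N h => ih N ((f.2.2.1 (N + k)).symm.trans
      ((congrArg (setLastZero (N + k)) h).trans (map_zero _)))
  refine Subtype.ext (funext fun N => ?_)
  exact hdown d N (by rw [add_comm]; exact hup N)

end Stability

/-! ### Elementary symmetric functions as free generators -/

section ElementaryGenerators

variable {R : Type*} [CommRing R]

theorem esymmEval_monomial_isHomogeneous (N : ℕ) (s : ℕ+ →₀ ℕ) (a : R) :
    (esymmEval R N (monomial s a)).IsHomogeneous (Finsupp.weight (fun n : ℕ+ => (n : ℕ)) s) := by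
  have he (n : ℕ) : (esymm (Fin N) R n).IsHomogeneous n := by
    refine IsHomogeneous.sum _ _ _ fun t ht => ?_
    have := IsHomogeneous.prod t (fun i => (X i : MvPolynomial (Fin N) R)) (fun _ => 1)
      fun i _ => isHomogeneous_X R i
    simpa [(Finset.mem_powersetCard.mp ht).2] using this
  rw [esymmEval, aeval_monomial, algebraMap_eq, ← zero_add (Finsupp.weight _ s),
    Finsupp.weight_apply]
  refine (isHomogeneous_C _ a).mul (IsHomogeneous.prod _ _ _ fun n _ => ?_)
  dsimp only
  rw [smul_eq_mul, mul_comm]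
  exact (he n).pow _

/-- Evaluation is graded once `e_n` has weight `n`; this allows truncation by degree before
evaluating. -/
theorem homogeneousComponent_esymmEval (N k : ℕ) (P : MvPolynomial ℕ+ R) :
    homogeneousComponent k (esymmEval R N P) =
      esymmEval R N (weightedHomogeneousComponent (fun n : ℕ+ => (n : ℕ)) k P) := by
  induction P using MvPolynomial.induction_on' with
  | add p q hp hq => simp only [map_add, hp, hq]
  | monomial s a =>
    rw [homogeneousComponent_of_mem (esymmEval_monomial_isHomogeneous N s a),
      weightedHomogeneousComponent_of_mem (isWeightedHomogeneous_monomial _ s a rfl)]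
    split_ifs <;> simp

theorem exists_esymmEval_eq {N : ℕ} {f : MvPolynomial (Fin N) R} (hf : f.IsSymmetric) :
    ∃ P, esymmEval R N P = f := by
  obtain ⟨Q, hQ⟩ := (esymmAlgHom_fin_bijective R N).2 ⟨f, hf⟩
  refine ⟨rename (fun i : Fin N => Nat.succPNat i) Q, ?_⟩
  rw [esymmEval, aeval_rename]
  exact (esymmAlgHom_apply Q).symm.trans (congrArg Subtype.val hQ)

theorem eq_zero_of_esymmEval_eq_zero {N : ℕ} {P : MvPolynomial ℕ+ R}
    (hP : ∀ n ∈ P.vars, (n : ℕ) ≤ N) (h : esymmEval R N P = 0) : P = 0 := by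
  have hinj : Function.Injective fun i : Fin N => Nat.succPNat i := by
    intro i j hij
    have := congrArg PNat.val hij
    simp only [Nat.succPNat_coe] at this
    exact Fin.ext (by omega)
  obtain ⟨Q, rfl⟩ := exists_rename_eq_of_vars_subset_range P
    (fun i : Fin N => Nat.succPNat i) hinj (by
      intro n hn
      have h1 := hP n hn
      have h2 := n.pos
      exact ⟨⟨n - 1, by omega⟩, PNat.eq (by simp only [Nat.succPNat_coe]; omega)⟩)
  rw [esymmEval, aeval_rename] at h
  have : esymmAlgHom (Fin N) R N Q = 0 :=
    Subtype.ext ((esymmAlgHom_apply Q).trans h)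
  rw [(map_eq_zero_iff _ (esymmAlgHom_fin_bijective R N).1).mp this, map_zero]

/-- The algebra morphism `ℝ[e₁, e₂, …] → Sym` sending each variable to the corresponding
elementary symmetric function. -/
noncomputable def ofElemReal : MvPolynomial ℕ+ ℝ →ₐ[ℝ] Sym :=
  aeval fun n : ℕ+ => elemSym n

theorem ofElemReal_apply (P : MvPolynomial ℕ+ ℝ) (N : ℕ) :
    (ofElemReal P).1 N = esymmEval ℝ N P := by
  have : ((Pi.evalAlgHom ℝ (fun N : ℕ => MvPolynomial (Fin N) ℝ) N).comp
      (Sym.val.comp ofElemReal)) = esymmEval ℝ N := by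
    refine algHom_ext fun n => ?_
    simp [ofElemReal, esymmEval, elemSym]
  exact congrArg (fun φ => φ P) this

theorem ofElemReal_bijective : Function.Bijective ofElemReal := by
  constructor
  · rw [injective_iff_map_eq_zero]
    intro P hP
    have h := ofElemReal_apply P (P.vars.sup fun n => (n : ℕ))
    rw [hP] at h
    exact eq_zero_of_esymmEval_eq_zero (fun n hn => Finset.le_sup (f := fun n : ℕ+ => (n : ℕ)) hn)
      h.symm
  · intro f
    obtain ⟨d, hd⟩ := f.2.2.2
    obtain ⟨P, hP⟩ := exists_esymmEval_eq (f.2.1 d)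
    -- Dropping weights above `d` leaves the value in `d` variables unchanged and bounds the degree
    -- by `d` in every number of variables, as `Sym.eq_zero_of_apply_eq_zero` requires.
    let Q := ∑ k ∈ Finset.range (d + 1),
      weightedHomogeneousComponent (fun n : ℕ+ => (n : ℕ)) k P
    have hQ (N : ℕ) : (ofElemReal Q).1 N =
        ∑ k ∈ Finset.range (d + 1), homogeneousComponent k (esymmEval ℝ N P) := by
      rw [ofElemReal_apply, map_sum]
      simp only [homogeneousComponent_esymmEval]
    refine ⟨Q, ?_⟩
    rw [← sub_eq_zero]
    refine Sym.eq_zero_of_apply_eq_zero (d := d) (fun N => ?_) ?_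
    · refine (totalDegree_sub _ _).trans (max_le ?_ (hd N))
      rw [hQ]
      refine (totalDegree_finsetSum _ _).trans (Finset.sup_le fun k hk => ?_)
      exact (homogeneousComponent_isHomogeneous k _).totalDegree_le.trans
        (Nat.lt_succ_iff.mp (Finset.mem_range.mp hk))
    · change (ofElemReal Q).1 d - f.1 d = 0
      rw [hQ, hP, sub_eq_zero]
      conv_rhs => rw [← sum_homogeneousComponent (f.1 d)]
      symm
      refine Finset.sum_subset (Finset.range_mono (Nat.succ_le_succ (hd d))) fun k _ hk => ?_
      exact homogeneousComponent_eq_zero _ _ (by simpa using hk)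

theorem ofElem_bijective : Function.Bijective ofElem := by
  let E : ℂ ⊗[ℝ] MvPolynomial ℕ+ ℝ ≃ₐ[ℂ] SymC :=
    Algebra.TensorProduct.congr AlgEquiv.refl (AlgEquiv.ofBijective _ ofElemReal_bijective)
  have h : ofElem = ((algebraTensorAlgEquiv ℝ ℂ).symm.trans E : MvPolynomial ℕ+ ℂ ≃ₐ[ℂ] SymC) := by
    refine algHom_ext fun n => ?_
    simp [ofElem, E, ofElemReal]
  have h' : (ofElem : MvPolynomial ℕ+ ℂ → SymC) =
      ((algebraTensorAlgEquiv ℝ ℂ).symm.trans E : MvPolynomial ℕ+ ℂ ≃ₐ[ℂ] SymC) :=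
    congrArg (fun φ : MvPolynomial ℕ+ ℂ →ₐ[ℂ] SymC => (φ : MvPolynomial ℕ+ ℂ → SymC)) h
  rw [h']
  exact AlgEquiv.bijective _

/-- The projection `Sym_ℂ → ℂ[x₁, …, x_N]`. -/
noncomputable def evalVars (N : ℕ) : SymC →ₐ[ℂ] MvPolynomial (Fin N) ℂ :=
  Algebra.TensorProduct.lift (Algebra.ofId ℂ _)
    ((mapAlgHom (Algebra.ofId ℝ ℂ) : MvPolynomial (Fin N) ℝ →ₐ[ℝ] MvPolynomial (Fin N) ℂ).comp
      ((Pi.evalAlgHom ℝ (fun N : ℕ => MvPolynomial (Fin N) ℝ) N).comp Sym.val))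
    fun _ _ => Commute.all _ _

theorem evalVars_tmul (N : ℕ) (f : Sym) :
    evalVars N ((1 : ℂ) ⊗ₜ[ℝ] f) = map (algebraMap ℝ ℂ) (f.1 N) := by
  simp [evalVars, Algebra.ofId]

theorem evalVars_ofElem (N : ℕ) (P : MvPolynomial ℕ+ ℂ) :
    evalVars N (ofElem P) = esymmEval ℂ N P := by
  have : (evalVars N).comp ofElem = esymmEval ℂ N := by
    refine algHom_ext fun n => ?_
    simp only [AlgHom.comp_apply, ofElem, aeval_X, evalVars_tmul, esymmEval, elemSym, map_esymm]
  exact congrArg (fun φ => φ P) this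

end ElementaryGenerators

/-! ### Schur functions span -/

section SchurSpan

theorem altOver_eq_sum_perm_cols {R : Type*} [CommRing R] {N : ℕ} (l : Fin N → ℕ) :
    altOver R l = ∑ σ : Equiv.Perm (Fin N), Equiv.Perm.sign σ • ∏ i, X (σ i) ^ l i := by
  rw [altOver, ← Matrix.det_transpose, Matrix.det_apply]
  rfl

/-- Antisymmetrisation multiplies an alternating polynomial by `N!` and turns each monomial into an
alternant. -/
theorem factorial_smul_eq_sum_altOver {R : Type*} [CommRing R] {N : ℕ} (g : MvPolynomial (Fin N) R)
    (hg : ∀ σ : Equiv.Perm (Fin N), rename σ g = (Equiv.Perm.sign σ : ℤ) • g) :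
    N.factorial • g = ∑ s ∈ g.support, coeff s g • altOver R s := by
  have h1 : ∑ σ : Equiv.Perm (Fin N), (Equiv.Perm.sign σ : ℤ) • rename σ g = N.factorial • g := by
    have (σ : Equiv.Perm (Fin N)) : (Equiv.Perm.sign σ : ℤ) • rename σ g = g := by
      rw [hg, smul_smul]
      rcases Int.units_eq_one_or (Equiv.Perm.sign σ) with hs | hs <;> simp [hs]
    simp only [this, Finset.sum_const, Finset.card_univ, Fintype.card_perm, Fintype.card_fin]
  have h2 (σ : Equiv.Perm (Fin N)) :
      rename σ g = ∑ s ∈ g.support, coeff s g • ∏ i, X (σ i) ^ s i := by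
    conv_lhs => rw [← support_sum_monomial_coeff g]
    rw [map_sum]
    refine Finset.sum_congr rfl fun s _ => ?_
    rw [monomial_eq, Finsupp.prod_fintype _ _ fun _ => pow_zero _, map_mul, map_prod, rename_C,
      smul_eq_C_mul]
    simp
  rw [← h1]
  simp only [h2, altOver_eq_sum_perm_cols, Finset.smul_sum, Units.smul_def]
  rw [Finset.sum_comm]
  refine Finset.sum_congr rfl fun s _ => Finset.sum_congr rfl fun σ _ => ?_
  rw [smul_comm]

theorem exists_rowLen_eq {μ : ℕ → ℕ} (hμ : Antitone μ) {N : ℕ} (hN : ∀ k, N ≤ k → μ k = 0) :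
    ∃ ν : YoungDiagram, ν.colLen 0 ≤ N ∧ ∀ k, ν.rowLen k = μ k := by
  let ν : YoungDiagram :=
    { cells := (Finset.range N ×ˢ Finset.range (μ 0)).filter fun c => c.2 < μ c.1
      isLowerSet := by
        rintro ⟨a, a'⟩ ⟨b, b'⟩ ⟨hb, hb'⟩ ha
        simp only [Finset.coe_filter, Finset.mem_product, Finset.mem_range, Set.mem_ofPred_eq]
          at ha hb hb' ⊢
        have := hμ hb
        omega }
  have hmem (i j : ℕ) : (i, j) ∈ ν ↔ j < μ i := by
    rw [← YoungDiagram.mem_cells]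
    simp only [ν, Finset.mem_filter, Finset.mem_product, Finset.mem_range]
    refine ⟨fun h => h.2, fun h => ⟨⟨?_, h.trans_le (hμ (Nat.zero_le i))⟩, h⟩⟩
    by_contra hi
    rw [hN i (not_lt.mp hi)] at h
    omega
  refine ⟨ν, ?_, fun k => ?_⟩
  · by_contra h
    have := (hmem N 0).mp (YoungDiagram.mem_iff_lt_colLen.mpr (not_le.mp h))
    rw [hN N le_rfl] at this
    omega
  · refine eq_of_forall_lt_iff fun m => ?_
    rw [← YoungDiagram.mem_iff_lt_rowLen, hmem]

theorem exists_rowExponent_eq {N : ℕ} {l : Fin N → ℕ} (hl : StrictAnti l) :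
    ∃ ν : YoungDiagram, ν.colLen 0 ≤ N ∧ rowExponent N ν = l := by
  have hstep (i j : Fin N) (hij : i ≤ j) : l j + (j - i : ℕ) ≤ l i := by
    obtain ⟨i, hi⟩ := i
    obtain ⟨j, hj⟩ := j
    obtain ⟨k, rfl⟩ := Nat.exists_eq_add_of_le (show i ≤ j from hij)
    clear hij
    dsimp only
    induction k with
    | zero => simp
    | succ k ih =>
      have h1 := ih (by omega)
      have h2 := hl (show (⟨i + k, by omega⟩ : Fin N) < ⟨i + (k + 1), hj⟩ by
        rw [Fin.mk_lt_mk]; omega)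
      omega
  have hlow (i : Fin N) : N - 1 - i ≤ l i := by
    have hi := i.2
    have := hstep i ⟨N - 1, by omega⟩ (by rw [Fin.le_def]; dsimp only; omega)
    dsimp only at this
    omega
  -- Strictly decreasing exponents dominate the staircase `N - 1 - k` (`hlow`), so this subtraction
  -- is never truncated.
  let μ : ℕ → ℕ := fun k => if h : k < N then l ⟨k, h⟩ - (N - 1 - k) else 0
  have hμ : Antitone μ := by
    intro i j hij
    simp only [μ]
    by_cases hj : j < N
    · have hi : i < N := hij.trans_lt hj
      have h1 := hstep ⟨i, hi⟩ ⟨j, hj⟩ hij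
      have h2 := hlow ⟨j, hj⟩
      have h3 := hlow ⟨i, hi⟩
      rw [dif_pos hj, dif_pos hi]
      dsimp only at h1 h2 h3
      omega
    · rw [dif_neg hj]
      exact Nat.zero_le _
  obtain ⟨ν, hν, hrow⟩ := exists_rowLen_eq hμ (N := N) fun k hk => dif_neg (not_lt.mpr hk)
  refine ⟨ν, hν, funext fun i => ?_⟩
  have := hlow i
  simp only [rowExponent, hrow, μ, dif_pos i.2, Fin.eta]
  omega

theorem altOver_eq_zero_or {R : Type*} [CommRing R] {N : ℕ} (l : Fin N → ℕ) :
    altOver R l = 0 ∨ ∃ ν : YoungDiagram, ν.colLen 0 ≤ N ∧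
      ν.card + ∑ i : Fin N, (N - 1 - i) = ∑ i, l i ∧
      (altOver R l = altOver R (rowExponent N ν) ∨
        altOver R l = -altOver R (rowExponent N ν)) := by
  by_cases hl : Function.Injective l
  · right
    -- `Tuple.sort` sorts increasingly; the reversal makes the exponents decrease.
    let σ : Equiv.Perm (Fin N) := Fin.revPerm.trans (Tuple.sort l)
    have hanti : StrictAnti (l ∘ σ) := by
      have h1 : StrictMono (l ∘ Tuple.sort l) :=
        (Tuple.monotone_sort l).strictMono_of_injective (hl.comp (Tuple.sort l).injective)
      intro i j hij
      exact h1 (Fin.rev_lt_rev.mpr hij)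
    obtain ⟨ν, hν, h⟩ := exists_rowExponent_eq hanti
    refine ⟨ν, hν, ?_, ?_⟩
    · rw [← Equiv.sum_comp σ l, ← sum_rowLen_eq_card hν, ← Finset.sum_add_distrib]
      exact Finset.sum_congr rfl fun i _ => congrFun h i
    · have := altOver_comp_perm (R := R) l σ
      rw [← h] at this
      rcases Int.units_eq_one_or (Equiv.Perm.sign σ) with hs | hs <;> simp [this, hs]
  · left
    simp only [Function.Injective, not_forall] at hl
    obtain ⟨i, j, hij, hne⟩ := hl
    exact altOver_eq_zero hne hij

theorem alternant_eq_altOver (N : ℕ) (ν : YoungDiagram) :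
    alternant N ν = altOver ℝ (rowExponent N ν) := rfl

theorem totalDegree_vandermondePoly_le (N : ℕ) :
    (vandermondePoly N).totalDegree ≤ ∑ i : Fin N, (N - 1 - i) := by
  refine (totalDegree_finsetProd _ _).trans (Finset.sum_le_sum fun i _ => ?_)
  refine (totalDegree_finsetProd _ _).trans ?_
  refine (Finset.sum_le_sum fun j _ => ((isHomogeneous_X ℝ i).sub
    (isHomogeneous_X ℝ j)).totalDegree_le).trans ?_
  simp

/-- `V * f` is alternating, hence a combination of alternants `V * S_ν`, and `V` cancels. Comparing
degrees with the staircase gives `|ν| ≤ d`, which `span_schur` needs in order to lift from `d`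
variables to `Sym`. -/
theorem mem_span_schurPoly {N d : ℕ} {f : MvPolynomial (Fin N) ℝ} (hf : f.IsSymmetric)
    (hd : f.totalDegree ≤ d) :
    f ∈ Submodule.span ℝ (schurPoly N '' {ν | ν.colLen 0 ≤ N ∧ ν.card ≤ d}) := by
  set S := Submodule.span ℝ (schurPoly N '' {ν | ν.colLen 0 ≤ N ∧ ν.card ≤ d}) with hS
  have hanti (σ : Equiv.Perm (Fin N)) : rename σ (vandermondePoly N * f) =
      (Equiv.Perm.sign σ : ℤ) • (vandermondePoly N * f) := by
    rw [map_mul, hf σ, vandermondePoly_eq, rename_alternant, smul_mul_assoc]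
  have hsum := factorial_smul_eq_sum_altOver _ hanti
  have halt : ∀ s ∈ (vandermondePoly N * f).support,
      altOver ℝ s ∈ S.map (LinearMap.mulLeft ℝ (vandermondePoly N)) := by
    intro s hs
    rcases altOver_eq_zero_or (R := ℝ) s with h0 | ⟨ν, hν, hcard, h⟩
    · rw [h0]
      exact zero_mem _
    · have h1 := (le_totalDegree hs).trans (totalDegree_mul _ _)
      rw [Finsupp.sum_fintype _ _ fun _ => rfl] at h1
      have h2 := totalDegree_vandermondePoly_le N
      have hmem : altOver ℝ (rowExponent N ν) ∈
          S.map (LinearMap.mulLeft ℝ (vandermondePoly N)) := by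
        rw [← alternant_eq_altOver, ← vandermondePoly_mul_schurPoly hν]
        exact Submodule.mem_map_of_mem (f := LinearMap.mulLeft ℝ (vandermondePoly N))
          (Submodule.subset_span ⟨ν, ⟨hν, by omega⟩, rfl⟩)
      rcases h with h | h
      · rw [h]; exact hmem
      · rw [h]; exact neg_mem hmem
  have hV : vandermondePoly N * f ∈ S.map (LinearMap.mulLeft ℝ (vandermondePoly N)) := by
    have h1 : (N.factorial : ℝ) • (vandermondePoly N * f) ∈
        S.map (LinearMap.mulLeft ℝ (vandermondePoly N)) := by
      rw [Nat.cast_smul_eq_nsmul, hsum]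
      exact Submodule.sum_mem _ fun s hs => Submodule.smul_mem _ _ (halt s hs)
    exact (Submodule.smul_mem_iff _ (Nat.cast_ne_zero.mpr N.factorial_ne_zero)).mp h1
  obtain ⟨g, hg, hgf⟩ := hV
  rw [← mul_left_cancel₀ (vandermondePoly_ne_zero N) hgf]
  exact hg

theorem span_schur : Submodule.span ℝ (Set.range schur) = ⊤ := by
  rw [eq_top_iff]
  rintro f -
  obtain ⟨d, hd⟩ := f.2.2.2
  let π : Sym →ₗ[ℝ] MvPolynomial (Fin d) ℝ := LinearMap.proj d ∘ₗ Sym.val.toLinearMap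
  have hf : π f ∈ (Submodule.span ℝ (schur '' {ν | ν.colLen 0 ≤ d ∧ ν.card ≤ d})).map π := by
    rw [Submodule.map_span, Set.image_image]
    exact mem_span_schurPoly (f.2.1 d) (hd d)
  obtain ⟨g, hg, hgf⟩ := hf
  have hgd : ∀ N, (g.1 N).totalDegree ≤ d := by
    clear hgf
    induction hg using Submodule.span_induction with
    | mem x hx =>
      obtain ⟨ν, hν, rfl⟩ := hx
      exact fun N => (totalDegree_schurPoly_le N ν).trans hν.2
    | zero => exact fun N => by simp
    | add x y _ _ hx hy =>
      exact fun N => (totalDegree_add _ _).trans (max_le (hx N) (hy N))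
    | smul a x _ hx => exact fun N => (totalDegree_smul_le _ _).trans (hx N)
  have h0 : f - g = 0 := Sym.eq_zero_of_apply_eq_zero (d := d)
    (fun N => (totalDegree_sub _ _).trans (max_le (hd N) (hgd N))) (sub_eq_zero.mpr hgf.symm)
  rw [sub_eq_zero.mp h0]
  exact Submodule.span_mono (Set.image_subset_range _ _) hg

theorem span_schurC : Submodule.span ℂ (Set.range schurC) = ⊤ := by
  rw [eq_top_iff]
  rintro x -
  induction x using TensorProduct.induction_on with
  | zero => exact zero_mem _
  | add x y hx hy => exact add_mem hx hy
  | tmul a f =>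
    have h : (1 : ℂ) ⊗ₜ[ℝ] f ∈ Submodule.span ℂ (Set.range schurC) := by
      have hf : f ∈ Submodule.span ℝ (Set.range schur) := by rw [span_schur]; trivial
      induction hf using Submodule.span_induction with
      | mem x hx =>
        obtain ⟨ν, rfl⟩ := hx
        exact Submodule.subset_span ⟨ν, rfl⟩
      | zero => rw [TensorProduct.tmul_zero]; exact zero_mem _
      | add x y _ _ hx hy => rw [TensorProduct.tmul_add]; exact add_mem hx hy
      | smul r x _ hx =>
        have : (1 : ℂ) ⊗ₜ[ℝ] (r • x) = (r : ℂ) • ((1 : ℂ) ⊗ₜ[ℝ] x) := by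
          rw [TensorProduct.tmul_smul, TensorProduct.smul_tmul', TensorProduct.smul_tmul']
          simp
        rw [this]
        exact Submodule.smul_mem _ _ hx
    have : a ⊗ₜ[ℝ] f = a • ((1 : ℂ) ⊗ₜ[ℝ] f) := by
      rw [TensorProduct.smul_tmul', smul_eq_mul, mul_one]
    rw [this]
    exact Submodule.smul_mem _ _ h

end SchurSpan

/-! ### The formal differential operator -/

section DifferentialOperator

theorem pderiv_comm {σ R : Type*} [CommRing R] (i j : σ) (P : MvPolynomial σ R) :
    pderiv i (pderiv j P) = pderiv j (pderiv i P) := by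
  classical
  have h : ⁅pderiv (R := R) i, pderiv (R := R) j⁆ =
      (0 : Derivation R (MvPolynomial σ R) (MvPolynomial σ R)) := by
    refine MvPolynomial.derivation_ext fun k => ?_
    simp only [Derivation.commutator_apply, pderiv_X, Pi.single_apply]
    split_ifs <;> simp
  have := congrArg (fun D : Derivation R (MvPolynomial σ R) (MvPolynomial σ R) => D P) h
  rw [Derivation.commutator_apply] at this
  exact sub_eq_zero.mp this

/-- The freedom in `T` lets several polynomials, or the chain rule in `N` variables, share one index
set. -/
theorem diffOp_eq_sum (z z' : ℂ) {P : MvPolynomial ℕ+ ℂ} {T : Finset ℕ+}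
    (hT : ∀ n ∉ T, pderiv n P = 0) :
    diffOp z z' P = ∑ n ∈ T, secondOrderCoeff n n * pderiv n (pderiv n P) +
      2 * ∑ p ∈ (T ×ˢ T).filter (fun p => p.2 < p.1),
        secondOrderCoeff p.1 p.2 * pderiv p.1 (pderiv p.2 P) +
      ∑ n ∈ T, firstOrderCoeff z z' n * pderiv n P := by
  rw [diffOp]
  refine congrArg₂ (· + ·) (congrArg₂ (· + ·) ?_ (congrArg (2 * ·) ?_)) ?_
  · refine finsum_eq_sum_of_support_subset _ fun n hn => ?_
    by_contra h
    exact hn (by dsimp only; rw [hT n h, map_zero, mul_zero])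
  · rw [finsum_eq_sum_of_support_subset (s := (T ×ˢ T).subtype fun p => p.2 < p.1)]
    · exact Finset.sum_subtype_eq_sum_filter
        fun p : ℕ+ × ℕ+ => secondOrderCoeff p.1 p.2 * pderiv p.1 (pderiv p.2 P)
    · rintro ⟨⟨m, n⟩, hmn⟩ hp
      by_contra h
      rw [Finset.mem_coe, Finset.mem_subtype, Finset.mem_product, not_and_or] at h
      refine hp ?_
      dsimp only
      rcases h with h | h
      · rw [pderiv_comm, hT m h, map_zero, mul_zero]
      · rw [hT n h, map_zero, mul_zero]
  · refine finsum_eq_sum_of_support_subset _ fun n hn => ?_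
    by_contra h
    exact hn (by dsimp only; rw [hT n h, mul_zero])

theorem pderiv_eq_zero_of_notMem {P : MvPolynomial ℕ+ ℂ} {T : Finset ℕ+} (h : P.vars ⊆ T) :
    ∀ n ∉ T, pderiv n P = 0 :=
  fun _ hn => pderiv_eq_zero_of_notMem_vars fun hm => hn (h hm)

/-- The formal differential operator as a linear map. -/
noncomputable def diffOpLinear (z z' : ℂ) : MvPolynomial ℕ+ ℂ →ₗ[ℂ] MvPolynomial ℕ+ ℂ where
  toFun := diffOp z z'
  map_add' P Q := by
    have hP := pderiv_eq_zero_of_notMem (Finset.subset_union_left (s₁ := P.vars) (s₂ := Q.vars))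
    have hQ := pderiv_eq_zero_of_notMem (Finset.subset_union_right (s₁ := P.vars) (s₂ := Q.vars))
    rw [diffOp_eq_sum z z' hP, diffOp_eq_sum z z' hQ,
      diffOp_eq_sum z z' fun n hn => by rw [map_add, hP n hn, hQ n hn, add_zero]]
    simp only [map_add, mul_add, Finset.sum_add_distrib]
    abel
  map_smul' a P := by
    have hP := pderiv_eq_zero_of_notMem (Finset.Subset.refl P.vars)
    rw [RingHom.id_apply, diffOp_eq_sum z z' hP,
      diffOp_eq_sum z z' fun n hn => by rw [Derivation.map_smul, hP n hn, smul_zero]]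
    simp only [Derivation.map_smul, mul_smul_comm, ← Finset.smul_sum, smul_add]

/-- The parameter `z` enters only the first-order coefficients, and linearly; this form prepares the
interpolation from integers `z = N`. -/
theorem diffOp_affine (z z' : ℂ) (P : MvPolynomial ℕ+ ℂ) :
    diffOp z z' P = diffOp 0 z' P + z • (diffOp 1 z' P - diffOp 0 z' P) := by
  have hP := pderiv_eq_zero_of_notMem (Finset.Subset.refl P.vars)
  have h (n : ℕ) : firstOrderCoeff z z' n =
      firstOrderCoeff 0 z' n + z • (firstOrderCoeff 1 z' n - firstOrderCoeff 0 z' n) := by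
    simp only [firstOrderCoeff]
    module
  rw [diffOp_eq_sum z z' hP, diffOp_eq_sum 0 z' hP, diffOp_eq_sum 1 z' hP, add_sub_add_left_eq_sub,
    ← Finset.sum_sub_distrib, Finset.smul_sum, add_assoc (_ + _), ← Finset.sum_add_distrib]
  congr 1
  refine Finset.sum_congr rfl fun n _ => ?_
  rw [h n, add_mul, smul_mul_assoc, sub_mul]

end DifferentialOperator

/-! ### The formal operator evaluated in `N` variables -/

section Evaluation

variable {N : ℕ}

theorem esymmEval_e (k : ℕ) : esymmEval ℂ N (e k) = esymm (Fin N) ℂ k := by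
  rw [e]
  split_ifs with h
  · exact aeval_X _ _
  · obtain rfl : k = 0 := by omega
    rw [map_one, esymm_zero]

theorem esymmEval_secondOrderCoeff (m n : ℕ+) :
    esymmEval ℂ N (secondOrderCoeff m n) = esymmGamma (Fin N) ℂ m n := by
  obtain ⟨k, hk⟩ : ∃ k, (m : ℕ) = k + 1 := ⟨m - 1, (Nat.sub_add_cancel m.pos).symm⟩
  rw [hk, esymmGamma_eq_sum, secondOrderCoeff, map_sum]
  refine Finset.sum_congr rfl fun j _ => ?_
  rw [map_smul, map_mul, esymmEval_e, esymmEval_e, smul_eq_C_mul,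
    show k + 1 + (n : ℕ) - 1 - j = k + n - j by omega]
  congr 1
  simp only [map_sub, map_add, map_mul, map_natCast, map_one, map_ofNat, Nat.cast_add, Nat.cast_one]
  ring

/-- The choice `b = z' - N + 1` is the one for which `b + N - n` equals `z' - n + 1`. -/
theorem esymmEval_firstOrderCoeff (z' : ℂ) (n : ℕ) :
    esymmEval ℂ N (firstOrderCoeff N z' n) =
      ((N : MvPolynomial (Fin N) ℂ) + 1 - (n : MvPolynomial (Fin N) ℂ)) *
        (C (z' - N + 1) + (N : MvPolynomial (Fin N) ℂ) - (n : MvPolynomial (Fin N) ℂ)) *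
          esymm (Fin N) ℂ (n - 1) - (n : MvPolynomial (Fin N) ℂ) * esymm (Fin N) ℂ n := by
  rw [firstOrderCoeff, map_add, map_smul, map_smul, esymmEval_e, esymmEval_e, smul_eq_C_mul,
    smul_eq_C_mul]
  simp only [map_sub, map_add, map_mul, map_natCast, map_one, map_neg]
  ring

theorem sum_sum_eq_diag_add {ι A : Type*} [LinearOrder ι] [CommRing A] (T : Finset ι)
    (F : ι → ι → A) (hF : ∀ m n, F m n = F n m) :
    ∑ m ∈ T, ∑ n ∈ T, F m n =
      ∑ n ∈ T, F n n + 2 * ∑ p ∈ (T ×ˢ T).filter (fun p => p.2 < p.1), F p.1 p.2 := by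
  have h (m : ι) : ∑ n ∈ T, F m n =
      ∑ n ∈ T, (if m = n then F m n else 0) +
        ∑ n ∈ T, (if n < m then F m n else 0) + ∑ n ∈ T, (if m < n then F m n else 0) := by
    rw [← Finset.sum_add_distrib, ← Finset.sum_add_distrib]
    refine Finset.sum_congr rfl fun n _ => ?_
    rcases lt_trichotomy m n with h | h | h
    · simp [h.ne, h, h.le]
    · simp [h]
    · simp [h.ne', h, h.le]
  have hswap : ∑ m ∈ T, ∑ n ∈ T, (if m < n then F m n else 0) =
      ∑ m ∈ T, ∑ n ∈ T, (if n < m then F m n else 0) := by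
    rw [Finset.sum_comm]
    exact Finset.sum_congr rfl fun m _ => Finset.sum_congr rfl fun n _ => by rw [hF n m]
  rw [Finset.sum_congr rfl fun m _ => h m, Finset.sum_add_distrib, Finset.sum_add_distrib, hswap,
    Finset.sum_filter, Finset.sum_product, add_assoc, two_mul]
  congr 1
  refine Finset.sum_congr rfl fun m hm => ?_
  rw [Finset.sum_ite_eq, if_pos hm]

theorem laguerreSum_vandermonde_mul_esymmEval_eq (z' : ℂ) (P : MvPolynomial ℕ+ ℂ) :
    laguerreSum (z' - N + 1) (vandermondeOver ℂ N * esymmEval ℂ N P) =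
      laguerreSum (z' - N + 1) (vandermondeOver ℂ N) * esymmEval ℂ N P +
        vandermondeOver ℂ N * esymmEval ℂ N (diffOp N z' P) := by
  -- The variables of `P` serve `diffOp_eq_sum`; the indices `1, …, N` cover every `e_n` that is
  -- nonzero in `N` variables.
  let T : Finset ℕ+ := P.vars ∪ (Finset.range N).image Nat.succPNat
  have hT : ∀ n ∉ T, esymm (Fin N) ℂ n = 0 := by
    intro n hn
    have : N < n := by
      by_contra hlt
      refine hn (Finset.mem_union_right _ (Finset.mem_image.mpr ⟨n.natPred, ?_, n.succPNat_natPred⟩))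
      have := n.natPred_add_one
      exact Finset.mem_range.mpr (by omega)
    rw [esymm, Finset.powersetCard_eq_empty.mpr (by simpa using this), Finset.sum_empty]
  rw [laguerreSum_vandermonde_mul_esymmEval _ T hT,
    diffOp_eq_sum _ _ (pderiv_eq_zero_of_notMem (T := T) Finset.subset_union_left)]
  congr 2
  rw [sum_sum_eq_diag_add T _ fun m n => by rw [pderiv_comm, esymmGamma_comm],
    map_add (esymmEval ℂ N), map_add (esymmEval ℂ N), map_mul (esymmEval ℂ N), map_sum, map_sum,
    map_sum, map_ofNat (esymmEval ℂ N)]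
  simp only [map_mul (esymmEval ℂ N), esymmEval_secondOrderCoeff, esymmEval_firstOrderCoeff]
  refine congrArg₂ (· + ·) (congrArg₂ (· + ·) ?_ (congrArg (2 * ·) ?_)) ?_ <;>
    exact Finset.sum_congr rfl fun _ _ => mul_comm _ _

end Evaluation

/-! ### Interpolation in `z` and conclusion -/

section Laguerre

/-- The value prescribed for the Laguerre operator on the Schur function `S_ν`. -/
noncomputable def laguerreValue (z z' : ℂ) (ν : YoungDiagram) : SymC :=
  -(ν.card : ℂ) • schurC ν +
    ∑ c : {c // c ∈ corners ν}, ((z + content c) * (z' + content c)) • schurC (removeCorner ν c)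

theorem laguerreValue_affine (z z' : ℂ) (ν : YoungDiagram) :
    laguerreValue z z' ν =
      laguerreValue 0 z' ν + z • (laguerreValue 1 z' ν - laguerreValue 0 z' ν) := by
  simp only [laguerreValue]
  rw [add_sub_add_left_eq_sub, ← Finset.sum_sub_distrib, Finset.smul_sum, add_assoc,
    ← Finset.sum_add_distrib]
  congr 1
  refine Finset.sum_congr rfl fun c _ => ?_
  module

theorem evalVars_schurC (N : ℕ) (ν : YoungDiagram) :
    evalVars N (schurC ν) = map (algebraMap ℝ ℂ) (schurPoly N ν) :=
  evalVars_tmul N (schur ν)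

/-- `laguerreSum` applied to `V * S_ν` is computed in two ways; the common term `laguerreSum b V *
S_ν` and then the factor `V` cancel. -/
theorem esymmEval_diffOp_of_ofElem_eq_schurC {N : ℕ} (z' : ℂ) {ν : YoungDiagram}
    (hν : ν.colLen 0 ≤ N) {P : MvPolynomial ℕ+ ℂ} (hP : ofElem P = schurC ν) :
    esymmEval ℂ N (diffOp N z' P) = evalVars N (laguerreValue N z' ν) := by
  have h1 := laguerreSum_vandermonde_mul_esymmEval_eq (N := N) z' P
  rw [← evalVars_ofElem N P, hP, evalVars_schurC,
    laguerreSum_vandermonde_mul_schurPoly _ hν] at h1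
  rw [← mul_left_cancel₀ vandermondeOver_ne_zero (add_left_cancel h1)]
  simp only [laguerreValue, map_add, map_sum, map_smul, evalVars_schurC]
  congr 1
  refine Finset.sum_congr rfl fun c _ => ?_
  congr 2
  ring

/-- Once `N` bounds every variable index in `P` and `Q`, evaluation loses nothing and `P + N • Q =
0`. Two consecutive values of `N` separate `P` from `Q`. -/
theorem eq_zero_of_forall_esymmEval_eq_zero {M : ℕ} {P Q : MvPolynomial ℕ+ ℂ}
    (h : ∀ N, M ≤ N → esymmEval ℂ N (P + (N : ℂ) • Q) = 0) : P = 0 ∧ Q = 0 := by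
  classical
  let B := max M (max (P.vars.sup fun n => (n : ℕ)) (Q.vars.sup fun n => (n : ℕ)))
  have hB (N : ℕ) (hN : B ≤ N) : P + (N : ℂ) • Q = 0 := by
    have hN' := max_le_iff.mp hN
    have hN'' := max_le_iff.mp hN'.2
    refine eq_zero_of_esymmEval_eq_zero (fun n hn => ?_) (h N hN'.1)
    rcases Finset.mem_union.mp (vars_add_subset _ _ hn) with h | h
    · exact (Finset.le_sup (f := fun n : ℕ+ => (n : ℕ)) h).trans hN''.1
    · rw [smul_eq_C_mul] at h
      have h := vars_mul _ _ h
      rw [vars_C, Finset.empty_union] at h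
      exact (Finset.le_sup (f := fun n : ℕ+ => (n : ℕ)) h).trans hN''.2
  have h1 := hB B le_rfl
  have h2 := hB (B + 1) (Nat.le_succ B)
  have hQ : Q = 0 := by
    rw [Nat.cast_add, Nat.cast_one, add_smul, one_smul, ← add_assoc, h1, zero_add] at h2
    exact h2
  rw [hQ, smul_zero, add_zero] at h1
  exact ⟨h1, hQ⟩

/-- Both sides are affine in `z` and agree in `N` variables at `z = N` for all large `N`, so their
constant terms and slopes agree. -/
theorem ofElem_diffOp_of_ofElem_eq_schurC (z z' : ℂ) {ν : YoungDiagram}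
    {P : MvPolynomial ℕ+ ℂ} (hP : ofElem P = schurC ν) :
    ofElem (diffOp z z' P) = laguerreValue z z' ν := by
  obtain ⟨Q₀, hQ₀⟩ := ofElem_bijective.2 (laguerreValue 0 z' ν)
  obtain ⟨Q₁, hQ₁⟩ := ofElem_bijective.2 (laguerreValue 1 z' ν)
  have hQ (w : ℂ) : ofElem (Q₀ + w • (Q₁ - Q₀)) = laguerreValue w z' ν := by
    rw [laguerreValue_affine w, map_add, map_smul, map_sub, hQ₀, hQ₁]
  have key := eq_zero_of_forall_esymmEval_eq_zero (M := ν.colLen 0)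
    (P := diffOp 0 z' P - Q₀) (Q := diffOp 1 z' P - diffOp 0 z' P - (Q₁ - Q₀)) fun N hN => by
      have h := esymmEval_diffOp_of_ofElem_eq_schurC z' hN hP
      rw [← hQ, evalVars_ofElem, ← sub_eq_zero, ← map_sub, diffOp_affine] at h
      rw [← h]
      congr 1
      module
  rw [← hQ z]
  congr 1
  rw [diffOp_affine, sub_eq_zero.mp key.2, sub_eq_zero.mp key.1]

end Laguerre

end LaguerreSym

theorem theorem1 (z z' : ℂ) :
    Function.Bijective LaguerreSym.ofElem ∧
    (∃! D : LaguerreSym.SymC →ₗ[ℂ] LaguerreSym.SymC, LaguerreSym.IsLaguerreOperator z z' D) ∧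
    ∀ D : LaguerreSym.SymC →ₗ[ℂ] LaguerreSym.SymC, LaguerreSym.IsLaguerreOperator z z' D →
      ∀ P : MvPolynomial ℕ+ ℂ,
        D (LaguerreSym.ofElem P) = LaguerreSym.ofElem (LaguerreSym.diffOp z z' P) := by
  let E := AlgEquiv.ofBijective LaguerreSym.ofElem LaguerreSym.ofElem_bijective
  let D₀ : LaguerreSym.SymC →ₗ[ℂ] LaguerreSym.SymC :=
    LaguerreSym.ofElem.toLinearMap ∘ₗ LaguerreSym.diffOpLinear z z' ∘ₗ E.symm.toLinearMap
  have hD₀ : LaguerreSym.IsLaguerreOperator z z' D₀ := fun ν =>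
    LaguerreSym.ofElem_diffOp_of_ofElem_eq_schurC z z'
      (AlgEquiv.apply_symm_apply E (LaguerreSym.schurC ν))
  have huniq (D : LaguerreSym.SymC →ₗ[ℂ] LaguerreSym.SymC)
      (hD : LaguerreSym.IsLaguerreOperator z z' D) : D = D₀ :=
    LinearMap.ext_on_range LaguerreSym.span_schurC fun ν => (hD ν).trans (hD₀ ν).symm
  refine ⟨LaguerreSym.ofElem_bijective, ⟨D₀, hD₀, huniq⟩, fun D hD P => ?_⟩
  rw [huniq D hD]
  exact congrArg (fun Q => LaguerreSym.ofElem (LaguerreSym.diffOp z z' Q))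
    (AlgEquiv.symm_apply_apply E P)
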